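/- Let $\nu,k\in\mathbb N$, $k\ge 1$, and equip $\mathbb Z^\nu$ with the metric $d(x,y)=\max_j|x_j-y_j|$. Let $\mathcal A_\Lambda=\bigotimes_{x\in\Lambda}\mathbb M_k$ for finite $\Lambda\subset\mathbb Z^\nu$, let $\mathcal A=\overline{\bigcup_\Lambda\mathcal A_\Lambda}^{\|\cdot\|}$ be the quasilocal $C^*$-algebra, $\mathcal A^{\rm loc}=\bigcup_\Lambda\mathcal A_\Lambda$, and let $\tau_x$ be the translation automorphisms, which carry $\mathcal A_\Lambda$ to $\mathcal A_{\Lambda+x}$. Let $(\Omega,\mathcal F,\mathbb P)$ be a probability space whose $\sigma$-algebra is countably generated, with an ergodic action $\{\vartheta_x\}_{x\in\mathbb Z^\nu}$ of the group $\mathbb Z^\nu$ by measurable, measure preserving maps. Let $\mathfrak h$ be an ergodic interaction: to each $\omega\in\Omega$ and each finite $Z\subset\mathbb Z^\nu$ it assigns $\mathfrak h(\omega,Z)\in\mathcal A$ such that, for every $Z$, almost surely $\mathfrak h(\omega,Z)=\mathfrak h(\omega,Z)^*\in\mathcal A_Z$; the map $\omega\mapsto\varphi(\mathfrak h(\omega,Z))$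 is measurable for all $\varphi\in\mathcal A^*$; and, for every $x\in\mathbb Z^\nu$, almost surely $\tau_x(\mathfrak h(\omega,Z))=\mathfrak h(\vartheta_x\omega,Z+x)$. Let $F:[0,\infty)\to(0,\infty)$ be an $F$-function, i.e. $F$ is non-increasing, $\sup_x\sum_{y}F(d(x,y))<\infty$, and for some constant $C_F$ one has $\sum_zF(d(x,z))F(d(z,y))\le C_F\,F(d(x,y))$ for all $x,y\in\mathbb Z^\nu$. Put $$\mathcal N^{\mathfrak h}_F(\omega)=\sup_{x,y\in\mathbb Z^\nu}\ \sum_{Z\ni x,y}\frac{\|\mathfrak h(\omega,Z)\|}{F(d(x,y))}\in[0,\infty].$$ If $\mathbb P[\mathcal N^{\mathfrak h}_F<\infty]>0$, then there is a map $\Gamma$ from $\Omega$ to the states of $\mathcal A$ such that: 1. $\Gamma$ is weak-$*$ measurable, i.e. $\omega\mapsto\Gamma_\omega(a)$ is measurable for every $a\in\mathcal A$; 2. $\Gamma$ is a disordered ground state of $\mathfrak h$: almost surely, for every finite $X\subset\mathbb Z^\nu$ and every $a\in\mathcal A_X$, the series $\delta_\omega(a)=\sum_{Z\cap X\ne\emptyset}[i\mathfrak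 h(\omega,Z),a]$ converges unconditionally in norm and $-i\,\Gamma_\omega(a^*\delta_\omega(a))\ge0$; 3. $\Gamma$ is translation covariant: almost surely, $\Gamma_{\vartheta_x\omega}\circ\tau_x=\Gamma_\omega$ for all $x\in\mathbb Z^\nu$. -/

import Mathlib

open MeasureTheory Filter
open scoped ENNReal NNReal ComplexOrder

noncomputable section

namespace SpinSystem

/-! ### The lattice, spin configurations, and a Hilbert space carrying all local matrix algebras -/

/-- The integer lattice `ℤ^ν`. As a product of copies of `ℤ` it carries the metric
`d(x, y) = max_j |x_j - y_j|`. -/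
abbrev Lattice (ν : ℕ) : Type := Fin ν → ℤ

/-- Configurations: a basis label in `{0, …, k-1}` at every site of the lattice. -/
abbrev Config (ν k : ℕ) : Type := Lattice ν → Fin k

/-- The Hilbert space `ℓ²(α)`. -/
abbrev L2 (α : Type) : Type := lp (fun _ : α => ℂ) 2

section PartialPermutation

variable {α : Type}

/-- `ψ ∘ f`, extended by `0` where `f` is undefined. -/
def pullFun (f : α ≃. α) (ψ : α → ℂ) (a : α) : ℂ := (f a).elim 0 ψ

theorem sum_pullFun_le (f : α ≃. α) (ψ : L2 α) (s : Finset α) :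
    ∑ a ∈ s, ‖pullFun f ψ a‖ ^ (2 : ℝ≥0∞).toReal ≤ ‖ψ‖ ^ (2 : ℝ≥0∞).toReal := by
  classical
  have h1 : ∑ a ∈ s, ‖pullFun f ψ a‖ ^ (2 : ℝ≥0∞).toReal
      = ∑ a ∈ s with (f a).isSome, ‖pullFun f ψ a‖ ^ (2 : ℝ≥0∞).toReal := by
    rw [Finset.sum_filter]
    refine Finset.sum_congr rfl fun a _ => ?_
    cases h : f a <;> simp [pullFun, h]
  have h2 : ∑ a ∈ s with (f a).isSome, ‖pullFun f ψ a‖ ^ (2 : ℝ≥0∞).toReal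
      = ∑ b ∈ s.biUnion (fun a => (f a).toFinset), ‖ψ b‖ ^ (2 : ℝ≥0∞).toReal := by
    refine Finset.sum_bij (fun a ha => (f a).get (Finset.mem_filter.1 ha).2) ?_ ?_ ?_ ?_
    · intro a ha
      simp only [Finset.mem_biUnion, Option.mem_toFinset]
      exact ⟨a, (Finset.mem_filter.1 ha).1, by simp⟩
    · intro a ha b hb hab
      refine f.inj (b := (f a).get (Finset.mem_filter.1 ha).2) (by simp) ?_
      rw [hab]; simp
    · intro b hb
      simp only [Finset.mem_biUnion, Option.mem_toFinset] at hb
      obtain ⟨a, ha, hab⟩ := hb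
      have hab' : f a = some b := hab
      exact ⟨a, Finset.mem_filter.2 ⟨ha, by simp [hab']⟩, by simp [hab']⟩
    · intro a ha
      obtain ⟨b, hb⟩ := Option.isSome_iff_exists.1 (Finset.mem_filter.1 ha).2
      simp [pullFun, hb]
  rw [h1, h2]
  exact lp.sum_rpow_le_norm_rpow (by norm_num) ψ _

/-- The contraction `ψ ↦ ψ ∘ f` of `ℓ²(α)` defined by a partial permutation `f` of `α`. -/
def pull (f : α ≃. α) : L2 α →L[ℂ] L2 α :=
  LinearMap.mkContinuous
    { toFun := fun ψ => ⟨pullFun f ψ, memℓp_gen' (sum_pullFun_le f ψ)⟩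
      map_add' := fun ψ φ => by
        ext a
        change (f a).elim 0 (fun b => ψ b + φ b) = (f a).elim 0 ψ + (f a).elim 0 φ
        cases f a <;> simp
      map_smul' := fun c ψ => by
        ext a
        change (f a).elim 0 (fun b => c * ψ b) = c * (f a).elim 0 ψ
        cases f a <;> simp }
    1 (fun ψ => by
      rw [one_mul]
      refine lp.norm_le_of_forall_sum_le (by norm_num) (norm_nonneg _) ?_
      exact sum_pullFun_le f ψ)

theorem pull_apply (f : α ≃. α) (ψ : L2 α) (a : α) :
    (pull f ψ : α → ℂ) a = (f a).elim 0 ψ := rfl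

theorem star_pull (f : α ≃. α) : star (pull f) = pull f.symm := by
  classical
  rw [ContinuousLinearMap.star_eq_adjoint]
  symm
  rw [ContinuousLinearMap.eq_adjoint_iff]
  intro ψ φ
  rw [lp.inner_eq_tsum, lp.inner_eq_tsum]
  have hs : Function.support (fun a => inner ℂ ((pull f.symm ψ : α → ℂ) a) (φ a))
      ⊆ {a | (f.symm a).isSome} := by
    intro a ha
    by_contra h
    have : f.symm a = none := by simpa using h
    simp [pull_apply, this] at ha
  have hs' : Function.support (fun a => inner ℂ (ψ a) ((pull f φ : α → ℂ) a))
      ⊆ {a | (f a).isSome} := by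
    intro a ha
    by_contra h
    have : f a = none := by simpa using h
    simp [pull_apply, this] at ha
  rw [← tsum_subtype_eq_of_support_subset hs, ← tsum_subtype_eq_of_support_subset hs']
  let e : {a | (f.symm a).isSome} ≃ {a | (f a).isSome} :=
    { toFun := fun a => ⟨(f.symm a.1).get a.2, by
        have h : f.symm a.1 = some ((f.symm a.1).get a.2) := by simp
        have := f.eq_some_iff.1 h
        simp [this]⟩
      invFun := fun a => ⟨(f a.1).get a.2, by
        have h : f a.1 = some ((f a.1).get a.2) := by simp
        have := f.eq_some_iff.2 h
        simp [this]⟩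
      left_inv := fun a => by
        ext
        have h : f.symm a.1 = some ((f.symm a.1).get a.2) := by simp
        have h2 := f.eq_some_iff.1 h
        simp [h2]
      right_inv := fun a => by
        ext
        have h : f a.1 = some ((f a.1).get a.2) := by simp
        have h2 := f.eq_some_iff.2 h
        simp [h2] }
  rw [← e.tsum_eq]
  refine tsum_congr fun a => ?_
  obtain ⟨a, ha⟩ := a
  obtain ⟨b, hb⟩ := Option.isSome_iff_exists.1 ha
  have h2 := f.eq_some_iff.1 hb
  have h3 : (e ⟨a, ha⟩ : α) = b := by simp [e, hb]
  rw [h3]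
  simp [pull_apply, h2, hb]

end PartialPermutation

variable {ν k : ℕ}

/-! ### Local algebras -/

/-- The configuration that equals `t` on `Λ` and `σ` off `Λ`. -/
def overwrite {Λ : Finset (Lattice ν)} (σ : Config ν k) (t : Λ → Fin k) : Config ν k :=
  fun x => if h : x ∈ Λ then t ⟨x, h⟩ else σ x

theorem restrict_overwrite {Λ : Finset (Lattice ν)} (σ : Config ν k) (t : Λ → Fin k) :
    Λ.restrict (overwrite σ t) = t := by
  ext x; simp [overwrite]

theorem overwrite_overwrite {Λ : Finset (Lattice ν)} (σ : Config ν k) (t t' : Λ → Fin k) :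
    overwrite (overwrite σ t) t' = overwrite σ t' := by
  ext x; by_cases h : x ∈ Λ <;> simp [overwrite, h]

theorem overwrite_restrict (Λ : Finset (Lattice ν)) (σ : Config ν k) :
    overwrite σ (Λ.restrict σ) = σ := by
  ext x; by_cases h : x ∈ Λ <;> simp [overwrite]

/-- The partial permutation of configurations underlying the matrix unit `|s⟩⟨t|` on `Λ`. -/
def unitPEquiv {Λ : Finset (Lattice ν)} (s t : Λ → Fin k) : Config ν k ≃. Config ν k where
  toFun σ := if Λ.restrict σ = s then some (overwrite σ t) else none
  invFun σ := if Λ.restrict σ = t then some (overwrite σ s) else none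
  inv σ ρ := by
    constructor
    · intro h
      split_ifs at h with h1
      obtain rfl := Option.some.inj h
      rw [if_pos (restrict_overwrite _ _), overwrite_overwrite, ← h1, overwrite_restrict]
    · intro h
      split_ifs at h with h1
      obtain rfl := Option.some.inj h
      rw [if_pos (restrict_overwrite _ _), overwrite_overwrite, ← h1, overwrite_restrict]

/-- The operator on `ℓ²(Config)` by which a matrix `M`, indexed by the configurations of the finite
volume `Λ`, acts on the sites in `Λ` (and as the identity on the other sites). -/
def localOp (Λ : Finset (Lattice ν)) (M : Matrix (Λ → Fin k) (Λ → Fin k) ℂ) :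
    L2 (Config ν k) →L[ℂ] L2 (Config ν k) :=
  ∑ s, ∑ t, M s t • pull (unitPEquiv s t)

theorem localOp_apply (Λ : Finset (Lattice ν)) (M : Matrix (Λ → Fin k) (Λ → Fin k) ℂ)
    (ψ : L2 (Config ν k)) (σ : Config ν k) :
    (localOp Λ M ψ : Config ν k → ℂ) σ = ∑ t, M (Λ.restrict σ) t * ψ (overwrite σ t) := by
  have h : ∀ s t : Λ → Fin k, (pull (unitPEquiv s t) ψ : Config ν k → ℂ) σ
      = if Λ.restrict σ = s then ψ (overwrite σ t) else 0 := by
    intro s t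
    rw [pull_apply]
    change Option.elim (if Λ.restrict σ = s then some (overwrite σ t) else none) 0 ψ = _
    split_ifs <;> rfl
  simp only [localOp, sum_apply, smul_apply,
    lp.coeFn_sum, Finset.sum_apply, lp.coeFn_smul, Pi.smul_apply, smul_eq_mul, h]
  rw [Finset.sum_comm]
  simp

/-- `localOp` as a unital `*`-homomorphism `M_k^{⊗Λ} → B(ℓ²(Config))`. -/
def localRep (Λ : Finset (Lattice ν)) :
    Matrix (Λ → Fin k) (Λ → Fin k) ℂ →⋆ₐ[ℂ] (L2 (Config ν k) →L[ℂ] L2 (Config ν k)) where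
  toFun := localOp Λ
  map_one' := by
    ext ψ σ
    rw [localOp_apply]
    simp [Matrix.one_apply, overwrite_restrict]
  map_mul' M N := by
    ext ψ σ
    rw [mul_apply_eq_comp, localOp_apply, localOp_apply]
    simp only [localOp_apply, restrict_overwrite, overwrite_overwrite, Matrix.mul_apply,
      Finset.sum_mul, Finset.mul_sum, mul_assoc]
    rw [Finset.sum_comm]
  map_zero' := by simp [localOp]
  map_add' M N := by
    simp [localOp, add_smul, Finset.sum_add_distrib]
  commutes' c := by
    ext ψ σ
    rw [localOp_apply]
    simp [Matrix.algebraMap_matrix_apply, overwrite_restrict, Algebra.algebraMap_eq_smul_one]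
  map_star' M := by
    simp only [localOp, star_sum, star_smul, star_pull]
    rw [Finset.sum_comm]
    rfl

theorem localRep_apply (Λ : Finset (Lattice ν)) (M : Matrix (Λ → Fin k) (Λ → Fin k) ℂ) :
    localRep Λ M = localOp Λ M := rfl

/-- The embedding `a ↦ a ⊗ 1` of the matrices over `Λ₀` into those over `Λ ⊇ Λ₀`. -/
def tensorOne {Λ₀ Λ : Finset (Lattice ν)} (h : Λ₀ ⊆ Λ) (M : Matrix (Λ₀ → Fin k) (Λ₀ → Fin k) ℂ) :
    Matrix (Λ → Fin k) (Λ → Fin k) ℂ :=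
  Matrix.of fun s t => if ∀ x : Λ, x.1 ∉ Λ₀ → s x = t x then
    M (fun x => s ⟨x.1, h x.2⟩) (fun x => t ⟨x.1, h x.2⟩) else 0

/-- The representations of the local algebras are compatible with the inclusions `a ↦ a ⊗ 1`. -/
theorem localRep_tensorOne {Λ₀ Λ : Finset (Lattice ν)} (h : Λ₀ ⊆ Λ)
    (M : Matrix (Λ₀ → Fin k) (Λ₀ → Fin k) ℂ) :
    localRep Λ (tensorOne h M) = localRep Λ₀ M := by
  ext ψ σ
  rw [localRep_apply, localRep_apply, localOp_apply, localOp_apply]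
  simp only [tensorOne, Matrix.of_apply, ite_mul, zero_mul]
  rw [← Finset.sum_filter]
  refine Finset.sum_bij' (fun t _ x => t ⟨x.1, h x.2⟩)
    (fun t _ => Λ.restrict (overwrite σ t)) ?_ ?_ ?_ ?_ ?_
  · intro t _; exact Finset.mem_univ _
  · intro t _
    simp only [Finset.mem_filter, Finset.mem_univ, true_and]
    intro x hx
    simp [overwrite, hx]
  · intro t ht
    simp only [Finset.mem_filter, Finset.mem_univ, true_and] at ht
    ext x
    by_cases hx : x.1 ∈ Λ₀
    · simp [overwrite, hx]
    · have := ht x hx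
      simp only [Finset.restrict] at this
      simp [overwrite, hx, this]
  · intro t _
    ext x
    simp [overwrite]
  · intro t ht
    simp only [Finset.mem_filter, Finset.mem_univ, true_and] at ht
    have : overwrite σ t = overwrite σ (fun x : Λ₀ => t ⟨x.1, h x.2⟩) := by
      ext x
      by_cases hx : x ∈ Λ₀
      · simp [overwrite, hx, h hx]
      · by_cases hx' : x ∈ Λ
        · have := ht ⟨x, hx'⟩ hx
          simp only [Finset.restrict] at this
          simp [overwrite, hx, hx', this]
        · simp [overwrite, hx, hx']
    rw [this]
    rfl

theorem localRep_injective (hk : 0 < k) (Λ : Finset (Lattice ν)) :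
    Function.Injective (localRep (k := k) Λ) := by
  classical
  rw [injective_iff_map_eq_zero]
  intro M hM
  ext s t
  let σ : Config ν k := overwrite (fun _ => ⟨0, hk⟩) s
  have h := congrArg (fun T : L2 (Config ν k) →L[ℂ] L2 (Config ν k) =>
    (T (lp.single 2 (overwrite σ t) (1 : ℂ)) : Config ν k → ℂ) σ) hM
  simp only [localRep_apply, localOp_apply] at h
  rw [Finset.sum_eq_single t] at h
  · simpa [σ, restrict_overwrite] using h
  · intro t' _ ht'
    have : overwrite σ t' ≠ overwrite σ t := fun e => ht' (by
      rw [← restrict_overwrite σ t', e, restrict_overwrite])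
    simp [lp.single_apply, this]
  · simp

/-! ### The quasilocal algebra -/

/-- The local operators, `⋃_Λ 𝒜_Λ` inside `B(ℓ²(Config))`. -/
def localUnion (ν k : ℕ) : StarSubalgebra ℂ (L2 (Config ν k) →L[ℂ] L2 (Config ν k)) :=
  ⨆ Λ : Finset (Lattice ν), (localRep (k := k) Λ).range

theorem coe_localUnion (ν k : ℕ) :
    (localUnion ν k : Set (L2 (Config ν k) →L[ℂ] L2 (Config ν k)))
      = ⋃ Λ : Finset (Lattice ν), Set.range (localRep (k := k) Λ) := by
  classical
  rw [localUnion, StarSubalgebra.coe_iSup_of_directed]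
  · rfl
  · refine Monotone.directed_le fun Λ₀ Λ h => ?_
    rintro _ ⟨M, rfl⟩
    exact ⟨tensorOne h M, localRep_tensorOne h M⟩

/-- The quasilocal `C*`-algebra `𝒜_{ℤ^ν}` with one-site algebras `M_k`: the norm closure of the
union of the local algebras. -/
abbrev Quasilocal (ν k : ℕ) : Type := (localUnion ν k).topologicalClosure

instance : CStarAlgebra (Quasilocal ν k) :=
  StarSubalgebra.cstarAlgebra _ (h_closed := (localUnion ν k).isClosed_topologicalClosure)

/-- The inclusion `ι_Λ : 𝒜_Λ = M_k^{⊗Λ} → 𝒜_{ℤ^ν}`. -/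
def ι (Λ : Finset (Lattice ν)) : Matrix (Λ → Fin k) (Λ → Fin k) ℂ →⋆ₐ[ℂ] Quasilocal ν k :=
  (localRep Λ).codRestrict _ fun M => (localUnion ν k).le_topologicalClosure
    (le_iSup (fun Λ : Finset (Lattice ν) => (localRep (k := k) Λ).range) Λ ⟨M, rfl⟩)

/-- The local algebra `𝒜_Λ`, as a subalgebra of the quasilocal algebra. -/
def localAlgebra (k : ℕ) (Λ : Finset (Lattice ν)) : StarSubalgebra ℂ (Quasilocal ν k) :=
  (ι (k := k) Λ).range

theorem ι_tensorOne {Λ₀ Λ : Finset (Lattice ν)} (h : Λ₀ ⊆ Λ)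
    (M : Matrix (Λ₀ → Fin k) (Λ₀ → Fin k) ℂ) : ι Λ (tensorOne h M) = ι Λ₀ M :=
  Subtype.ext (localRep_tensorOne h M)

open scoped Matrix.Norms.L2Operator in
/-- The inclusions are isometric for the operator norm of matrices. -/
theorem isometry_ι (hk : 0 < k) (Λ : Finset (Lattice ν)) : Isometry (ι (k := k) Λ) :=
  NonUnitalStarAlgHom.isometry (ι (k := k) Λ)
    ((StarAlgHom.injective_codRestrict _ _ _).2 (localRep_injective hk Λ))

theorem dense_iUnion_localAlgebra (ν k : ℕ) :
    Dense (⋃ Λ : Finset (Lattice ν), (localAlgebra k Λ : Set (Quasilocal ν k))) := by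
  intro a
  rw [closure_subtype]
  have : ((↑) '' ⋃ Λ : Finset (Lattice ν), (localAlgebra k Λ : Set (Quasilocal ν k)))
      = (localUnion ν k : Set (L2 (Config ν k) →L[ℂ] L2 (Config ν k))) := by
    rw [coe_localUnion, Set.image_iUnion]
    refine Set.iUnion_congr fun Λ => ?_
    change _ '' Set.range _ = _
    rw [← Set.range_comp]
    rfl
  rw [this]
  exact a.2

/-! ### Translations -/

/-- The translate `{z + x : z ∈ Z}` of a finite volume. -/
def shift (x : Lattice ν) (Z : Finset (Lattice ν)) : Finset (Lattice ν) :=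
  Z.map (Equiv.addRight x).toEmbedding

/-- The permutation `σ ↦ σ(· + x)` of configurations. -/
def shiftConfig (k : ℕ) (x : Lattice ν) : Config ν k ≃ Config ν k where
  toFun σ := fun y => σ (y + x)
  invFun σ := fun y => σ (y - x)
  left_inv σ := by ext; simp
  right_inv σ := by ext; simp

theorem pull_mul_pull_symm {α : Type} (e : α ≃ α) :
    pull e.toPEquiv * pull e.symm.toPEquiv = 1 := by
  ext ψ a
  simp [pull_apply, Equiv.toPEquiv]

/-- The unitary `ψ ↦ ψ ∘ shiftConfig x` implementing the translation by `x`. -/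
def shiftUnitary (k : ℕ) (x : Lattice ν) : unitary (L2 (Config ν k) →L[ℂ] L2 (Config ν k)) :=
  ⟨pull (shiftConfig k x).toPEquiv, by
    rw [Unitary.mem_iff, star_pull, ← Equiv.toPEquiv_symm]
    exact ⟨pull_mul_pull_symm (shiftConfig k x).symm, pull_mul_pull_symm _⟩⟩

/-- The configuration `y ↦ s (y + x)` on `Λ` defined by a configuration `s` on `Λ + x`. -/
def unshift {Λ : Finset (Lattice ν)} (x : Lattice ν) (s : shift x Λ → Fin k) : Λ → Fin k :=
  fun y => s ⟨y.1 + x, Finset.mem_map_of_mem _ y.2⟩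

theorem conj_shiftUnitary_localRep (x : Lattice ν) (Λ : Finset (Lattice ν))
    (M : Matrix (Λ → Fin k) (Λ → Fin k) ℂ) :
    Unitary.conjStarAlgAut ℂ _ (shiftUnitary k x) (localRep Λ M) =
      localRep (shift x Λ) (M.submatrix (unshift x) (unshift x)) := by
  ext ψ σ
  have hU : ∀ (φ : L2 (Config ν k)) (ρ : Config ν k),
      ((shiftUnitary k x : L2 (Config ν k) →L[ℂ] L2 (Config ν k)) φ : Config ν k → ℂ) ρ
        = φ (fun y => ρ (y + x)) := fun φ ρ => rfl
  have hU' : ∀ (φ : L2 (Config ν k)) (ρ : Config ν k),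
      ((star (shiftUnitary k x : L2 (Config ν k) →L[ℂ] L2 (Config ν k))) φ : Config ν k → ℂ) ρ
        = φ (fun y => ρ (y - x)) := fun φ ρ => by
    change (star (pull (shiftConfig k x).toPEquiv) φ : Config ν k → ℂ) ρ = _
    rw [star_pull]; rfl
  rw [Unitary.conjStarAlgAut_apply, mul_apply_eq_comp, mul_apply_eq_comp, hU,
    localRep_apply Λ]
  rw [localRep_apply, localOp_apply, localOp_apply]
  simp only [hU']
  let e : (shift x Λ → Fin k) ≃ (Λ → Fin k) :=
    { toFun := unshift x
      invFun := fun t y => t ⟨y.1 - x, by simpa [shift, sub_eq_add_neg] using y.2⟩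
      left_inv := fun s => by ext; simp [unshift]
      right_inv := fun t => by ext; simp [unshift] }
  rw [← e.sum_comp]
  refine Finset.sum_congr rfl fun t _ => ?_
  have h1 : Λ.restrict (fun y => σ (y + x))
      = unshift x ((shift x Λ).restrict σ) := rfl
  have h2 : (fun y => overwrite (fun y => σ (y + x)) (e t) (y - x)) = overwrite σ t := by
    ext y
    by_cases hy : y - x ∈ Λ
    · have hy' : y ∈ shift x Λ := by simpa [shift, sub_eq_add_neg] using hy
      simp [overwrite, hy, hy', e, unshift]
    · have hy' : y ∉ shift x Λ := by simpa [shift, sub_eq_add_neg] using hy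
      simp [overwrite, hy, hy']
  rw [h1, h2]
  rfl

theorem conj_shiftUnitary_mem (x : Lattice ν) (a : Quasilocal ν k) :
    Unitary.conjStarAlgAut ℂ _ (shiftUnitary k x) a.1 ∈ (localUnion ν k).topologicalClosure := by
  have hc : Continuous (Unitary.conjStarAlgAut ℂ _ (shiftUnitary (ν := ν) k x)) := by
    exact (continuous_const.mul continuous_id).mul continuous_const
  refine map_mem_closure hc a.2 fun b hb => ?_
  have hb' : b ∈ (localUnion ν k : Set (L2 (Config ν k) →L[ℂ] L2 (Config ν k))) := hb
  change _ ∈ (localUnion ν k : Set (L2 (Config ν k) →L[ℂ] L2 (Config ν k)))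
  rw [coe_localUnion] at hb' ⊢
  obtain ⟨_, ⟨Λ, rfl⟩, ⟨M, rfl⟩⟩ := hb'
  exact Set.mem_iUnion.2 ⟨shift x Λ, _, (conj_shiftUnitary_localRep x Λ M).symm⟩

/-- The translation automorphism `τ_x` of the quasilocal algebra. -/
def translation (x : Lattice ν) : Quasilocal ν k →⋆ₐ[ℂ] Quasilocal ν k :=
  StarAlgHom.codRestrict
    ((Unitary.conjStarAlgAut ℂ _ (shiftUnitary k x) : _ →⋆ₐ[ℂ] _).comp
      (localUnion ν k).topologicalClosure.subtype) _ (conj_shiftUnitary_mem x)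

/-- `τ_x` moves the matrix at the sites of `Λ` to the sites of `Λ + x`. -/
theorem translation_ι (x : Lattice ν) (Λ : Finset (Lattice ν))
    (M : Matrix (Λ → Fin k) (Λ → Fin k) ℂ) :
    translation x (ι Λ M) = ι (shift x Λ) (M.submatrix (unshift x) (unshift x)) :=
  Subtype.ext (conj_shiftUnitary_localRep x Λ M)

theorem shiftUnitary_add (x y : Lattice ν) :
    shiftUnitary k (x + y) = shiftUnitary k x * shiftUnitary k y := by
  ext ψ σ
  change ψ (fun z => σ (z + (x + y))) = ψ (fun z => σ (z + y + x))
  have : (fun z => σ (z + (x + y))) = fun z => σ (z + y + x) := by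
    funext z
    rw [add_comm x y, add_assoc]
  rw [this]

theorem translation_add (x y : Lattice ν) (a : Quasilocal ν k) :
    translation (x + y) a = translation x (translation y a) := by
  refine Subtype.ext ?_
  change Unitary.conjStarAlgAut ℂ _ (shiftUnitary k (x + y)) a.1
    = Unitary.conjStarAlgAut ℂ _ (shiftUnitary k x)
      (Unitary.conjStarAlgAut ℂ _ (shiftUnitary k y) a.1)
  rw [shiftUnitary_add, map_mul]
  rfl

theorem translation_zero (a : Quasilocal ν k) : translation 0 a = a := by
  have h : shiftUnitary (ν := ν) k 0 = 1 := by
    have := shiftUnitary_add (ν := ν) (k := k) 0 0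
    rw [add_zero] at this
    simpa using this
  refine Subtype.ext ?_
  change Unitary.conjStarAlgAut ℂ _ (shiftUnitary k 0) a.1 = a.1
  rw [h, map_one]
  rfl

/-! ### Interactions -/

variable {Ω : Type*} [MeasurableSpace Ω]

/-- A disordered interaction: for every finite volume `Z`, the element `h(ω, Z)` is almost surely a
self-adjoint element of `𝒜_Z`, and `ω ↦ h(ω, Z)` is weakly measurable. -/
structure IsDisorderedInteraction (P : Measure Ω)
    (h : Ω → Finset (Lattice ν) → Quasilocal ν k) : Prop where
  isSelfAdjoint : ∀ Z, ∀ᵐ ω ∂P, IsSelfAdjoint (h ω Z)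
  mem_localAlgebra : ∀ Z, ∀ᵐ ω ∂P, h ω Z ∈ localAlgebra k Z
  measurable : ∀ Z, ∀ φ : StrongDual ℂ (Quasilocal ν k), Measurable fun ω => φ (h ω Z)

/-- A disordered interaction is ergodic, with respect to an action `ϑ_x ω = x +ᵥ ω` of `ℤ^ν` on
the probability space by measurable, measure preserving maps which is ergodic, if it is covariant:
`τ_x (h(ω, Z)) = h(ϑ_x ω, Z + x)` almost surely. -/
structure IsErgodicInteraction (P : Measure Ω) [AddAction (Lattice ν) Ω]
    [MeasurableConstVAdd (Lattice ν) Ω] [ErgodicVAdd (Lattice ν) Ω P]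
    (h : Ω → Finset (Lattice ν) → Quasilocal ν k) : Prop
    extends IsDisorderedInteraction P h where
  covariant : ∀ x Z, ∀ᵐ ω ∂P, translation x (h ω Z) = h (x +ᵥ ω) (shift x Z)

/-- `F : [0, ∞) → (0, ∞)` is an `F`-function on `ℤ^ν`. -/
structure IsFFunction (ν : ℕ) (F : ℝ≥0 → ℝ≥0) : Prop where
  pos : ∀ r, 0 < F r
  antitone : Antitone F
  summable : ∃ C : ℝ≥0, ∀ x : Lattice ν, ∑' y : Lattice ν, (F (nndist x y) : ℝ≥0∞) ≤ C
  convolution : ∃ C : ℝ≥0, ∀ x y : Lattice ν,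
    ∑' z : Lattice ν, (F (nndist x z) * F (nndist z y) : ℝ≥0∞) ≤ C * F (nndist x y)

/-- The `F`-norm `sup_{x,y} ∑_{Z ∋ x,y} ‖Φ(Z)‖ / F(d(x,y)) ∈ [0, ∞]` of an interaction `Φ`. -/
def FNorm (F : ℝ≥0 → ℝ≥0) (Φ : Finset (Lattice ν) → Quasilocal ν k) : ℝ≥0∞ :=
  ⨆ (x : Lattice ν) (y : Lattice ν),
    ∑' Z : {Z : Finset (Lattice ν) // x ∈ Z ∧ y ∈ Z}, ‖Φ Z.1‖ₑ / (F (nndist x y) : ℝ≥0∞)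

/-! ### Ground states -/

/-- The states of the quasilocal algebra. -/
def stateSpace (ν k : ℕ) : Set (StrongDual ℂ (Quasilocal ν k)) :=
  {φ | (∀ a, 0 ≤ φ (star a * a)) ∧ φ 1 = 1}

/-- The terms `[i Φ(Z), a]`, over the finite volumes `Z` that meet `X`, of the derivation of `Φ` at
`a ∈ 𝒜_X`. -/
def derivationTerm (Φ : Finset (Lattice ν) → Quasilocal ν k) (X : Finset (Lattice ν))
    (a : Quasilocal ν k) (Z : {Z : Finset (Lattice ν) // ¬ Disjoint Z X}) : Quasilocal ν k :=
  (Complex.I • Φ Z.1) * a - a * (Complex.I • Φ Z.1)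

/-- The state `φ` has the ground state property for the interaction `Φ`: for each local observable
`a ∈ 𝒜_X` the series `δ(a) = ∑_{Z ∩ X ≠ ∅} [i Φ(Z), a]` converges in norm, and
`-i φ(a* δ(a)) ≥ 0` (in particular, this number is real). -/
def IsGroundState (Φ : Finset (Lattice ν) → Quasilocal ν k)
    (φ : StrongDual ℂ (Quasilocal ν k)) : Prop :=
  ∀ X : Finset (Lattice ν), ∀ a ∈ localAlgebra k X,
    Summable (derivationTerm Φ X a) ∧
      0 ≤ -Complex.I * φ (star a * ∑' Z, derivationTerm Φ X a Z)

/-- A disordered ground state: a weak-* measurable map from the probability space to the states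
which almost surely has the ground state property. -/
structure IsDisorderedGroundState (P : Measure Ω) (h : Ω → Finset (Lattice ν) → Quasilocal ν k)
    (Γ : Ω → StrongDual ℂ (Quasilocal ν k)) : Prop where
  mem_stateSpace : ∀ ω, Γ ω ∈ stateSpace ν k
  measurable : ∀ a, Measurable fun ω => Γ ω a
  isGroundState : ∀ᵐ ω ∂P, IsGroundState (h ω) (Γ ω)

end SpinSystem

end

/-!
A random ground state is obtained as a limit of *approximately covariant approximate ground states*,
by a compactness argument in a Hilbert space in place of a fixed point theorem.

**Compactness.** A decreasing sequence of nonempty bounded midpoint-convex subsets of a Hilbert space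
contains a Cauchy sequence of members (`exists_cauchySeq_of_antitone_of_midpoint_mem`). Applied to
the values of random functionals on a dense sequence of observables, regarded as elements of
`L²(Ω × ℕ)`, and after passage to an almost everywhere convergent subsequence, this yields: a
decreasing sequence of nonempty midpoint-convex sets `C n` of random states has members `Γs n ∈ C n`
which converge almost surely in the weak-* topology
(`exists_ae_tendsto_of_antitone_of_midpoint_mem`). Hence every closed condition that holds on `C n`
up to an error vanishing with `n` passes to the limit, pointwise in `ω`.

**The sets.** `C n = approxCovariantGroundStates P h n` consists of the random states which have the
ground state property up to `1 / (n + 1)` plus the tail of the interaction beyond the cube of size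
`n`, and are covariant up to the relative boundary size of that cube. For nonemptiness one chooses
approximate ground states of the Hamiltonian of the cube of size `2n`, measurably in `ω`, and
averages them over the translations in the cube of size `n`; the average is nearly covariant because
cubes form a Følner sequence, and by covariance of the interaction each translate is an approximate
ground state of `h(ω, ·)` in a translated cube, which still contains the cube of size `n`.
Approximate ground states of one Hamiltonian `H` are vector states at the bottom `e` of its numerical
range, where `H - e` is positive and hence almost annihilates the vector; the choice is made
measurable by restriction to a dense sequence of Hamiltonians (`exists_measurable_isNearGround`).

**Summability.** Ergodicity upgrades finiteness of the `F`-norm with positive probability to almost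
sure finiteness (`ae_fNorm_lt_top`), and a finite `F`-norm makes the interaction summable over the
volumes that meet a given one, so that the derivation converges and its tails vanish.
-/

open scoped Topology

noncomputable section

namespace SpinSystem

/-! ### Convergent sequences in decreasing families of convex sets -/

/-- A decreasing sequence of nonempty bounded midpoint-convex sets in an inner product space admits
a Cauchy sequence of members: take elements of almost minimal norm and use the parallelogram law. -/
theorem exists_cauchySeq_of_antitone_of_midpoint_mem {E : Type*} [NormedAddCommGroup E]
    [InnerProductSpace ℂ E] {K : ℕ → Set E} (hK : Antitone K) (hne : ∀ n, (K n).Nonempty)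
    (hmid : ∀ n, ∀ x ∈ K n, ∀ y ∈ K n, (2⁻¹ : ℂ) • (x + y) ∈ K n)
    {R : ℝ} (hR : ∀ x ∈ K 0, ‖x‖ ≤ R) :
    ∃ y : ℕ → E, (∀ n, y n ∈ K n) ∧ CauchySeq y := by
  let d : ℕ → ℝ := fun n => sInf ((fun x => ‖x‖ ^ 2) '' K n)
  have hbdd : ∀ n, BddBelow ((fun x : E => ‖x‖ ^ 2) '' K n) := fun n =>
    ⟨0, by rintro _ ⟨x, -, rfl⟩; positivity⟩
  have hd : ∀ n, ∀ x ∈ K n, d n ≤ ‖x‖ ^ 2 := fun n x hx =>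
    csInf_le (hbdd n) ⟨x, hx, rfl⟩
  have hmono : Monotone d := fun n m hnm =>
    csInf_le_csInf (hbdd n) ((hne m).image _) (Set.image_mono (hK hnm))
  have hub : BddAbove (Set.range d) := by
    refine ⟨R ^ 2, ?_⟩
    rintro _ ⟨n, rfl⟩
    obtain ⟨x, hx⟩ := hne n
    refine (hd n x hx).trans ?_
    have := hR x (hK (Nat.zero_le n) hx)
    gcongr
  have hlim := tendsto_atTop_ciSup hmono hub
  set D := ⨆ n, d n
  have hdD : ∀ n, d n ≤ D := fun n => le_ciSup hub n
  have hex : ∀ n : ℕ, ∃ y ∈ K n, ‖y‖ ^ 2 < d n + 1 / ((n : ℝ) + 1) := fun n => by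
    have hlt : d n < d n + 1 / ((n : ℝ) + 1) := lt_add_of_pos_right _ Nat.one_div_pos_of_nat
    obtain ⟨_, ⟨y, hy, rfl⟩, h⟩ := exists_lt_of_csInf_lt ((hne n).image _) hlt
    exact ⟨y, hy, h⟩
  choose y hyK hy using hex
  refine ⟨y, hyK, cauchySeq_of_le_tendsto_0'
    (fun n => √(2 * (D - d n) + 4 * (1 / ((n : ℝ) + 1)))) (fun n m hnm => ?_) ?_⟩
  · rw [dist_eq_norm]
    refine Real.le_sqrt_of_sq_le ?_
    have hp := parallelogram_law_with_norm ℂ (y n) (y m)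
    have h1 := hd n _ (hmid n _ (hyK n) _ (hK hnm (hyK m)))
    rw [norm_smul, mul_pow] at h1
    norm_num at h1
    have h2 : 1 / ((m : ℝ) + 1) ≤ 1 / ((n : ℝ) + 1) := Nat.one_div_le_one_div hnm
    have := hy n
    have := hy m
    have := hdD m
    linarith
  · have h := ((hlim.const_sub D).const_mul 2).add
      ((tendsto_one_div_add_atTop_nhds_zero_nat (𝕜 := ℝ)).const_mul 4)
    simpa using h.sqrt

section RandomFunctionals

variable {A : Type*} [NormedAddCommGroup A] [NormedSpace ℂ A]

/-- A sequence of functionals of norm at most one that converges pointwise on a dense sequence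
converges pointwise to a continuous functional. -/
theorem exists_strongDual_tendsto_of_dense {φ : ℕ → StrongDual ℂ A} [CompleteSpace A]
    (hφ : ∀ n, ‖φ n‖ ≤ 1) {u : ℕ → A} (hu : DenseRange u)
    (hc : ∀ j, ∃ c, Tendsto (fun n => φ n (u j)) atTop (𝓝 c)) :
    ∃ ψ : StrongDual ℂ A, ∀ a, Tendsto (fun n => φ n a) atTop (𝓝 (ψ a)) := by
  have key : ∀ a, ∃ c, Tendsto (fun n => φ n a) atTop (𝓝 c) := by
    intro a
    refine cauchySeq_tendsto_of_complete (Metric.cauchySeq_iff'.2 fun ε hε => ?_)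
    obtain ⟨j, hj⟩ := hu.exists_dist_lt a (ε := ε / 3) (by positivity)
    obtain ⟨N, hN⟩ := Metric.cauchySeq_iff'.1 (hc j).choose_spec.cauchySeq (ε / 3) (by positivity)
    refine ⟨N, fun n hn => ?_⟩
    have h1 : ∀ m, dist (φ m a) (φ m (u j)) < ε / 3 := fun m => by
      rw [dist_eq_norm, ← map_sub]
      refine lt_of_le_of_lt ((φ m).le_of_opNorm_le (hφ m) _) ?_
      rwa [one_mul, ← dist_eq_norm]
    have h2 := hN n hn
    have h3 := h1 n
    have h4 := h1 N
    rw [dist_comm] at h4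
    have := dist_triangle4 (φ n a) (φ n (u j)) (φ N (u j)) (φ N a)
    linarith
  choose f hf using key
  exact ⟨continuousLinearMapOfTendsto φ (tendsto_pi_nhds.2 hf), hf⟩

variable {Ω : Type*} [MeasurableSpace Ω]

/-- Selection of an almost surely weak-* convergent sequence of random functionals. The values
`Γ ω (v j)` at a dense sequence of directions form an element of the Hilbert space
`L²(Ω × ℕ)`, where `exists_cauchySeq_of_antitone_of_midpoint_mem` applies; a subsequence converges
almost everywhere. -/
theorem exists_ae_tendsto_of_antitone_of_midpoint_mem [CompleteSpace A]
    [TopologicalSpace.SeparableSpace A]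
    (P : Measure Ω) [IsFiniteMeasure P] {S : Set (StrongDual ℂ A)} (hSne : S.Nonempty)
    (hS1 : ∀ φ ∈ S, ‖φ‖ ≤ 1)
    (hScl : ∀ (φ : ℕ → StrongDual ℂ A) (ψ : StrongDual ℂ A), (∀ n, φ n ∈ S) →
      (∀ a, Tendsto (fun n => φ n a) atTop (𝓝 (ψ a))) → ψ ∈ S)
    {C : ℕ → Set (Ω → StrongDual ℂ A)} (hC : Antitone C) (hne : ∀ n, (C n).Nonempty)
    (hCS : ∀ Γ ∈ C 0, ∀ ω, Γ ω ∈ S) (hCm : ∀ Γ ∈ C 0, ∀ a, Measurable fun ω => Γ ω a)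
    (hmid : ∀ n, ∀ Γ ∈ C n, ∀ Γ' ∈ C n, (2⁻¹ : ℂ) • (Γ + Γ') ∈ C n) :
    ∃ (Γs : ℕ → Ω → StrongDual ℂ A) (Γ : Ω → StrongDual ℂ A), (∀ n, Γs n ∈ C n) ∧
      (∀ ω, Γ ω ∈ S) ∧ (∀ a, Measurable fun ω => Γ ω a) ∧
      ∀ᵐ ω ∂P, ∀ a, Tendsto (fun n => Γs n ω a) atTop (𝓝 (Γ ω a)) := by
  classical
  obtain ⟨φ₀, hφ₀⟩ := hSne
  let u : ℕ → A := TopologicalSpace.denseSeq A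
  have hu : DenseRange u := TopologicalSpace.denseRange_denseSeq A
  let v : ℕ → A := fun j => ((1 + ‖u j‖ : ℝ) : ℂ)⁻¹ • u j
  have hpos : ∀ j, 0 < 1 + ‖u j‖ := fun j => by positivity
  have hv : ∀ j, ‖v j‖ ≤ 1 := fun j => by
    simp only [v, norm_smul, norm_inv, Complex.norm_real, Real.norm_eq_abs, abs_of_pos (hpos j)]
    rw [inv_mul_le_one₀ (hpos j)]
    linarith
  have huv : ∀ j, u j = ((1 + ‖u j‖ : ℝ) : ℂ) • v j := fun j => by
    simp only [v]
    rw [smul_inv_smul₀]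
    exact_mod_cast (hpos j).ne'
  let κ : Measure ℕ := (Measure.count : Measure ℕ).toFinite
  have hκ : ae κ = ⊤ := by
    rw [ae_toFinite]
    ext s
    simp [mem_ae_iff, Measure.count_eq_zero_iff]
  let μ : Measure (Ω × ℕ) := P.prod κ
  let J : (Ω → StrongDual ℂ A) → Ω × ℕ → ℂ := fun Γ p => Γ p.1 (v p.2)
  have hC0 : ∀ n, C n ⊆ C 0 := fun n => hC (Nat.zero_le n)
  have hJm : ∀ Γ ∈ C 0, Measurable (J Γ) := fun Γ hΓ =>
    measurable_from_prod_countable_left fun j => hCm Γ hΓ (v j)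
  have hJb : ∀ Γ ∈ C 0, ∀ p, ‖J Γ p‖ ≤ 1 := fun Γ hΓ p =>
    ((Γ p.1).le_of_opNorm_le_of_le (hS1 _ (hCS Γ hΓ p.1)) (hv p.2)).trans (by norm_num)
  have hJL : ∀ Γ ∈ C 0, MemLp (J Γ) 2 μ := fun Γ hΓ =>
    MemLp.of_bound (hJm Γ hΓ).aestronglyMeasurable 1 (.of_forall (hJb Γ hΓ))
  let K : ℕ → Set (Lp ℂ 2 μ) := fun n => {f | ∃ Γ ∈ C n, f =ᵐ[μ] J Γ}
  have hK : Antitone K := by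
    rintro n m hnm f ⟨Γ, hΓ, hf⟩
    exact ⟨Γ, hC hnm hΓ, hf⟩
  obtain ⟨f, hfK, hf⟩ := exists_cauchySeq_of_antitone_of_midpoint_mem (K := K) hK
    (fun n => by
      obtain ⟨Γ, hΓ⟩ := hne n
      exact ⟨(hJL Γ (hC0 n hΓ)).toLp _, Γ, hΓ, MemLp.coeFn_toLp _⟩)
    (by
      rintro n f ⟨Γ, hΓ, hf⟩ g ⟨Γ', hΓ', hg⟩
      refine ⟨_, hmid n _ hΓ _ hΓ', ?_⟩
      filter_upwards [hf, hg, Lp.coeFn_smul (2⁻¹ : ℂ) (f + g), Lp.coeFn_add f g]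
        with p h1 h2 h3 h4
      rw [h3, Pi.smul_apply, h4, Pi.add_apply, h1, h2]
      rfl)
    (R := (μ.real Set.univ) ^ ((2 : ℝ≥0∞).toReal)⁻¹ * 1)
    (by
      rintro f ⟨Γ, hΓ, hf⟩
      refine Lp.norm_le_of_ae_bound zero_le_one ?_
      filter_upwards [hf] with p hp
      rw [hp]
      exact hJb Γ hΓ p)
  obtain ⟨g, hg⟩ := cauchySeq_tendsto_of_complete hf
  obtain ⟨ns, hns, hae⟩ := (tendstoInMeasure_of_tendsto_Lp hg).exists_seq_tendsto_ae
  choose Γ₀ hΓ₀ hfΓ using hfK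
  let Γs : ℕ → Ω → StrongDual ℂ A := fun i => Γ₀ (ns i)
  have hΓs : ∀ i, Γs i ∈ C i := fun i => hC hns.le_apply (hΓ₀ _)
  have hae' : ∀ᵐ ω ∂P, ∀ j, ∃ c, Tendsto (fun i => Γs i ω (v j)) atTop (𝓝 c) := by
    have h : ∀ᵐ p ∂μ, ∃ c, Tendsto (fun i => J (Γs i) p) atTop (𝓝 c) := by
      filter_upwards [hae, ae_all_iff.2 hfΓ] with p h1 h2
      exact ⟨g p, h1.congr fun i => h2 _⟩
    filter_upwards [Measure.ae_ae_of_ae_prod h] with ω hω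
    rw [hκ, eventually_top] at hω
    exact hω
  let G : Set Ω := {ω | ∀ j, ∃ c, Tendsto (fun i => Γs i ω (v j)) atTop (𝓝 c)}
  have hG : MeasurableSet G := by
    have : G = ⋂ j, {ω | ∃ c, Tendsto (fun i => Γs i ω (v j)) atTop (𝓝 c)} := by
      ext ω; simp [G]
    rw [this]
    exact MeasurableSet.iInter fun j =>
      measurableSet_exists_tendsto fun i => hCm _ (hC0 i (hΓs i)) (v j)
  have hex : ∀ ω : Ω, ∃ ψ : StrongDual ℂ A,
      ∀ a, Tendsto (fun i => if ω ∈ G then Γs i ω a else φ₀ a) atTop (𝓝 (ψ a)) := by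
    intro ω
    by_cases hω : ω ∈ G
    · simp only [hω, if_true]
      refine exists_strongDual_tendsto_of_dense (fun n => hS1 _ (hCS _ (hC0 n (hΓs n)) ω)) hu
        fun j => ?_
      obtain ⟨c, hc⟩ := hω j
      refine ⟨((1 + ‖u j‖ : ℝ) : ℂ) * c, ?_⟩
      refine (hc.const_mul ((1 + ‖u j‖ : ℝ) : ℂ)).congr fun i => ?_
      rw [← smul_eq_mul, ← map_smul, ← huv j]
    · simp only [hω, if_false]
      exact ⟨φ₀, fun a => tendsto_const_nhds⟩
  choose Γ hΓ using hex
  refine ⟨Γs, Γ, hΓs, fun ω => ?_, fun a => ?_, ?_⟩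
  · refine hScl (fun i => if ω ∈ G then Γs i ω else φ₀) _ (fun n => ?_) fun a => ?_
    · split_ifs
      exacts [hCS _ (hC0 n (hΓs n)) ω, hφ₀]
    · refine (hΓ ω a).congr fun i => ?_
      split_ifs <;> rfl
  · exact measurable_of_tendsto_metrizable
      (fun i => Measurable.ite hG (hCm _ (hC0 i (hΓs i)) a) measurable_const)
      (tendsto_pi_nhds.2 fun ω => hΓ ω a)
  · filter_upwards [hae'] with ω hω a
    have : ω ∈ G := hω
    simpa only [this, if_true] using hΓ ω a

end RandomFunctionals

/-! ### Approximate ground states of a single Hamiltonian -/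

/-- `φ` is a ground state of the Hamiltonian `H` up to an error `ε`: for every `a`, the number
`φ(a* [H, a])` has distance at most `ε ‖a‖²` from a nonnegative real number. -/
def IsNearGround {A : Type*} [CStarAlgebra A] (H : A) (ε : ℝ) (φ : StrongDual ℂ A) : Prop :=
  ∀ a, ∃ t : ℝ, 0 ≤ t ∧ ‖φ (star a * (H * a - a * H)) - t‖ ≤ ε * ‖a‖ ^ 2

theorem IsNearGround.of_norm_sub_le {A : Type*} [CStarAlgebra A] {H H' : A} {ε η : ℝ}
    {φ : StrongDual ℂ A} (h : IsNearGround H ε φ) (hφ : ‖φ‖ ≤ 1) (hH : ‖H' - H‖ ≤ η) :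
    IsNearGround H' (ε + 2 * η) φ := by
  intro a
  obtain ⟨t, ht, hat⟩ := h a
  refine ⟨t, ht, ?_⟩
  have h1 : φ (star a * (H' * a - a * H')) - t
      = φ (star a * ((H' - H) * a - a * (H' - H))) + (φ (star a * (H * a - a * H)) - t) := by
    rw [← add_sub_assoc, ← map_add]
    congr 2
    noncomm_ring
  have h2 : ‖φ (star a * ((H' - H) * a - a * (H' - H)))‖ ≤ 2 * η * ‖a‖ ^ 2 := by
    refine ((φ.le_of_opNorm_le hφ _).trans_eq (one_mul _)).trans ((norm_mul_le _ _).trans ?_)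
    rw [norm_star]
    have h3 : ‖(H' - H) * a - a * (H' - H)‖ ≤ 2 * η * ‖a‖ := by
      refine (norm_sub_le _ _).trans ?_
      have := (norm_mul_le (H' - H) a).trans (mul_le_mul_of_nonneg_right hH (norm_nonneg a))
      have := (norm_mul_le a (H' - H)).trans (mul_le_mul_of_nonneg_left hH (norm_nonneg a))
      linarith
    calc ‖a‖ * ‖(H' - H) * a - a * (H' - H)‖ ≤ ‖a‖ * (2 * η * ‖a‖) := by gcongr
      _ = 2 * η * ‖a‖ ^ 2 := by ring
  rw [h1]
  refine (norm_add_le _ _).trans ?_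
  linarith

/-- The states, with the (automatic) bound on their norm recorded. -/
def normedStates (ν k : ℕ) : Set (StrongDual ℂ (Quasilocal ν k)) :=
  {φ | φ ∈ stateSpace ν k ∧ ‖φ‖ ≤ 1}

variable {ν k : ℕ}

/-- The functional `a ↦ ⟨ψ, a ψ⟩`. -/
def vectorFunctional (ψ : L2 (Config ν k)) : StrongDual ℂ (Quasilocal ν k) :=
  LinearMap.mkContinuous
    { toFun := fun a => inner ℂ ψ (a.1 ψ)
      map_add' := fun a b => by simp
      map_smul' := fun c a => by simp }
    (‖ψ‖ * ‖ψ‖) (fun a => by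
      refine (norm_inner_le_norm (𝕜 := ℂ) ψ (a.1 ψ)).trans ?_
      calc ‖ψ‖ * ‖a.1 ψ‖ ≤ ‖ψ‖ * (‖a.1‖ * ‖ψ‖) := by gcongr; exact a.1.le_opNorm ψ
        _ = ‖ψ‖ * ‖ψ‖ * ‖a‖ := by rw [mul_comm ‖a.1‖, ← mul_assoc]; rfl)

theorem vectorFunctional_apply (ψ : L2 (Config ν k)) (a : Quasilocal ν k) :
    vectorFunctional ψ a = inner ℂ ψ (a.1 ψ) := rfl

theorem inner_star_mul_apply {E : Type*} [NormedAddCommGroup E] [InnerProductSpace ℂ E]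
    [CompleteSpace E] (a b : E →L[ℂ] E) (ψ : E) :
    inner ℂ ψ ((star a * b) ψ) = inner ℂ (a ψ) (b ψ) := by
  rw [ContinuousLinearMap.star_eq_adjoint, mul_apply_eq_comp,
    ContinuousLinearMap.adjoint_inner_right]

theorem vectorFunctional_mem (ψ : L2 (Config ν k)) (hψ : ‖ψ‖ = 1) :
    vectorFunctional ψ ∈ normedStates ν k := by
  refine ⟨⟨fun a => ?_, ?_⟩, ?_⟩
  · rw [vectorFunctional_apply]
    change 0 ≤ inner ℂ ψ ((star a.1 * a.1) ψ)
    rw [inner_star_mul_apply, inner_self_eq_norm_sq_to_K]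
    exact (Complex.zero_le_real.2 (sq_nonneg ‖a.1 ψ‖)).trans_eq (Complex.ofReal_pow _ _)
  · rw [vectorFunctional_apply]
    change inner ℂ ψ ψ = 1
    rw [inner_self_eq_norm_sq_to_K, hψ]
    simp
  · refine (LinearMap.mkContinuous_norm_le _ (by positivity) _).trans ?_
    simp [hψ]

/-- A self-adjoint operator on a Hilbert space has approximate eigenvectors at the bottom `E` of its
numerical range, and `T - E` is positive. -/
theorem exists_approx_ground_vector {E : Type*} [NormedAddCommGroup E] [InnerProductSpace ℂ E]
    [CompleteSpace E] [Nontrivial E] {T : E →L[ℂ] E} (hT : IsSelfAdjoint T) {ε : ℝ} (hε : 0 < ε) :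
    ∃ (e : ℝ) (ψ : E), ‖ψ‖ = 1 ∧ (T - (e : ℂ) • 1).IsPositive ∧ ‖(T - (e : ℂ) • 1) ψ‖ ≤ ε := by
  let s : Set ℝ := (fun ψ => (inner ℂ (T ψ) ψ).re) '' Metric.sphere (0 : E) 1
  have hsne : s.Nonempty := ((NormedSpace.sphere_nonempty (E := E)).2 zero_le_one).image _
  have hsbdd : BddBelow s := by
    refine ⟨-‖T‖, ?_⟩
    rintro _ ⟨ψ, hψ, rfl⟩
    have hψ' : ‖ψ‖ = 1 := by simpa using hψ
    have h1 := Complex.abs_re_le_norm (inner ℂ (T ψ) ψ)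
    have h2 := norm_inner_le_norm (𝕜 := ℂ) (T ψ) ψ
    have h3 := T.le_opNorm ψ
    rw [hψ'] at h2 h3
    have := abs_le.1 h1
    dsimp only
    linarith
  let e := sInf s
  let K : E →L[ℂ] E := T - (e : ℂ) • 1
  have hKre : ∀ x, (inner ℂ (K x) x).re = (inner ℂ (T x) x).re - e * ‖x‖ ^ 2 := by
    intro x
    simp only [K, sub_apply, smul_apply, one_apply_eq_self, inner_sub_left, inner_smul_left,
      Complex.conj_ofReal, Complex.sub_re, Complex.re_ofReal_mul]
    rw [inner_self_eq_norm_sq_to_K]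
    norm_cast
  have hKsa : IsSelfAdjoint K := by
    refine hT.sub (IsSelfAdjoint.smul ?_ (.one _))
    exact Complex.conj_ofReal e
  have hKpos : K.IsPositive := by
    refine (ContinuousLinearMap.isPositive_iff_complex K).2 fun x => ⟨?_, ?_⟩
    · have := hKsa.isSymmetric.coe_re_inner_apply_self x
      exact this
    · change 0 ≤ (inner ℂ (K x) x).re
      rw [hKre, sub_nonneg]
      rcases eq_or_ne x 0 with rfl | hx
      · simp
      have hx' : 0 < ‖x‖ := norm_pos_iff.2 hx
      have h1 : e ≤ (inner ℂ (T (((‖x‖⁻¹ : ℝ) : ℂ) • x)) (((‖x‖⁻¹ : ℝ) : ℂ) • x)).re := by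
        refine csInf_le hsbdd ⟨_, ?_, rfl⟩
        rw [mem_sphere_zero_iff_norm, norm_smul, Complex.norm_real, norm_inv, norm_norm,
          inv_mul_cancel₀ hx'.ne']
      rw [map_smul, inner_smul_left, inner_smul_right, Complex.conj_ofReal, Complex.re_ofReal_mul,
        Complex.re_ofReal_mul] at h1
      calc e * ‖x‖ ^ 2 ≤ (‖x‖⁻¹ * (‖x‖⁻¹ * (inner ℂ (T x) x).re)) * ‖x‖ ^ 2 := by gcongr
        _ = _ := by field_simp
  obtain ⟨S, hS⟩ := CStarAlgebra.nonneg_iff_eq_star_mul_self.1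
    ((ContinuousLinearMap.nonneg_iff_isPositive K).2 hKpos)
  have hη : 0 < ε ^ 2 / (1 + ‖S‖ ^ 2) := by positivity
  obtain ⟨_, ⟨ψ, hψ, rfl⟩, hlt⟩ := exists_lt_of_csInf_lt hsne (lt_add_of_pos_right e hη)
  have hψ' : ‖ψ‖ = 1 := by simpa using hψ
  refine ⟨e, ψ, hψ', hKpos, ?_⟩
  change ‖K ψ‖ ≤ ε
  -- `‖S ψ‖² = ⟨ψ, K ψ⟩` is small, and `K ψ = S* S ψ`.
  have h1 : ‖S ψ‖ ^ 2 ≤ ε ^ 2 / (1 + ‖S‖ ^ 2) := by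
    have h2 : (inner ℂ (K ψ) ψ).re = ‖S ψ‖ ^ 2 := by
      rw [← inner_conj_symm, Complex.conj_re, hS, inner_star_mul_apply, inner_self_eq_norm_sq_to_K]
      norm_cast
    rw [← h2, hKre, hψ']
    dsimp only at hlt
    linarith
  have h3 : ‖K ψ‖ ≤ ‖S‖ * ‖S ψ‖ := by
    rw [hS, mul_apply_eq_comp]
    exact ((star S).le_opNorm _).trans_eq (by rw [norm_star])
  refine abs_le_of_sq_le_sq' ?_ hε.le |>.2
  calc ‖K ψ‖ ^ 2 ≤ (‖S‖ * ‖S ψ‖) ^ 2 := by gcongr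
    _ = ‖S‖ ^ 2 * ‖S ψ‖ ^ 2 := mul_pow _ _ _
    _ ≤ (1 + ‖S‖ ^ 2) * (ε ^ 2 / (1 + ‖S‖ ^ 2)) := by gcongr; linarith
    _ = ε ^ 2 := by field_simp

theorem nontrivial_l2_config (hk : 0 < k) : Nontrivial (L2 (Config ν k)) := by
  classical
  refine ⟨lp.single 2 (fun _ => ⟨0, hk⟩) 1, 0, fun h => ?_⟩
  have := congrArg (fun ψ : L2 (Config ν k) => ψ (fun _ => ⟨0, hk⟩)) h
  simp at this

theorem exists_isNearGround (hk : 0 < k) {H : Quasilocal ν k} (hH : IsSelfAdjoint H) {ε : ℝ}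
    (hε : 0 < ε) : ∃ φ ∈ normedStates ν k, IsNearGround H ε φ := by
  have := nontrivial_l2_config (ν := ν) hk
  have hT : IsSelfAdjoint H.1 := congrArg Subtype.val hH
  obtain ⟨e, ψ, hψ, hpos, hsmall⟩ := exists_approx_ground_vector hT hε
  refine ⟨vectorFunctional ψ, vectorFunctional_mem ψ hψ, fun a => ?_⟩
  set K := H.1 - (e : ℂ) • 1
  have hcomm : star a.1 * (H.1 * a.1 - a.1 * H.1)
      = star a.1 * (K * a.1) - star a.1 * (a.1 * K) := by
    simp only [K, sub_mul, mul_sub, smul_mul_assoc, mul_smul_comm, one_mul, mul_one]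
    abel
  have hval : vectorFunctional ψ (star a * (H * a - a * H))
      = inner ℂ (a.1 ψ) (K (a.1 ψ)) - inner ℂ (a.1 ψ) (a.1 (K ψ)) := by
    rw [vectorFunctional_apply]
    change inner ℂ ψ ((star a.1 * (H.1 * a.1 - a.1 * H.1)) ψ) = _
    rw [hcomm, sub_apply, inner_sub_right, inner_star_mul_apply, inner_star_mul_apply]
    rfl
  obtain ⟨h1, h2⟩ := (ContinuousLinearMap.isPositive_iff_complex K).1 hpos (a.1 ψ)
  refine ⟨_, h2, ?_⟩
  have h3 : inner ℂ (a.1 ψ) (K (a.1 ψ)) = ((RCLike.re (inner ℂ (K (a.1 ψ)) (a.1 ψ)) : ℝ) : ℂ) := by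
    rw [← inner_conj_symm, ← h1]
    exact Complex.conj_ofReal _
  rw [hval, h3, sub_sub_cancel_left, norm_neg]
  have ha : ‖a.1‖ = ‖a‖ := rfl
  calc ‖inner ℂ (a.1 ψ) (a.1 (K ψ))‖ ≤ ‖a.1 ψ‖ * ‖a.1 (K ψ)‖ := norm_inner_le_norm _ _
    _ ≤ (‖a.1‖ * ‖ψ‖) * (‖a.1‖ * ‖K ψ‖) := by
      gcongr <;> exact a.1.le_opNorm _
    _ ≤ (‖a.1‖ * ‖ψ‖) * (‖a.1‖ * ε) := by gcongr
    _ = ε * ‖a‖ ^ 2 := by rw [hψ, ha]; ring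

/-- Measurable choice of approximate ground states: the choice made for a Hamiltonian `H₀` is also
good for the Hamiltonians close to `H₀`, so that choices along a dense sequence suffice. -/
theorem exists_measurable_isNearGround [TopologicalSpace.SeparableSpace (Quasilocal ν k)]
    {Ω : Type*} [MeasurableSpace Ω] (hk : 0 < k) {H : Ω → Quasilocal ν k}
    (hH : StronglyMeasurable H) (hsa : ∀ ω, IsSelfAdjoint (H ω)) {ε : ℝ} (hε : 0 < ε) :
    ∃ Γ : Ω → StrongDual ℂ (Quasilocal ν k), (∀ ω, Γ ω ∈ normedStates ν k) ∧
      (∀ a, Measurable fun ω => Γ ω a) ∧ ∀ ω, IsNearGround (H ω) ε (Γ ω) := by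
  classical
  have : SecondCountableTopology (Quasilocal ν k) :=
    UniformSpace.secondCountable_of_separable _
  let H₀ : ℕ → selfAdjoint (Quasilocal ν k) := TopologicalSpace.denseSeq _
  choose φ hφ hφg using fun j => exists_isNearGround hk (H₀ j).2 (half_pos hε)
  have hex : ∀ ω, ∃ j, ‖H ω - H₀ j‖ < ε / 4 := fun ω => by
    obtain ⟨j, hj⟩ := (TopologicalSpace.denseRange_denseSeq
      (selfAdjoint (Quasilocal ν k))).exists_dist_lt ⟨H ω, hsa ω⟩ (ε := ε / 4) (by positivity)
    refine ⟨j, ?_⟩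
    rwa [Subtype.dist_eq, dist_eq_norm] at hj
  have hmeas : Measurable fun ω => Nat.find (hex ω) :=
    measurable_find hex fun j =>
      measurableSet_lt (hH.sub stronglyMeasurable_const).norm.measurable measurable_const
  refine ⟨fun ω => φ (Nat.find (hex ω)), fun ω => hφ _, fun a => ?_, fun ω => ?_⟩
  · exact (measurable_from_nat (f := fun j => φ j a)).comp hmeas
  · have h := (hφg (Nat.find (hex ω))).of_norm_sub_le (hφ _).2 (Nat.find_spec (hex ω)).le
    have h2 : ε / 2 + 2 * (ε / 4) = ε := by ring
    rwa [h2] at h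

/-! ### The quasilocal algebra: separability, locality, translations -/

instance finiteDimensional_localAlgebra (Λ : Finset (Lattice ν)) :
    FiniteDimensional ℂ (localAlgebra k Λ).toSubalgebra.toSubmodule := by
  refine Module.Finite.of_surjective
    ((ι (k := k) Λ).toAlgHom.toLinearMap.codRestrict
      (localAlgebra k Λ).toSubalgebra.toSubmodule fun M => ⟨M, rfl⟩) ?_
  rintro ⟨_, M, rfl⟩
  exact ⟨M, rfl⟩

theorem separableSpace_quasilocal : TopologicalSpace.SeparableSpace (Quasilocal ν k) := by
  have h1 : TopologicalSpace.IsSeparable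
      (⋃ Λ : Finset (Lattice ν), (localAlgebra k Λ : Set (Quasilocal ν k))) := by
    refine .iUnion fun Λ => ?_
    let V := (localAlgebra k Λ).toSubalgebra.toSubmodule
    have : ProperSpace V := FiniteDimensional.proper ℂ V
    have : SecondCountableTopology V := secondCountable_of_proper
    have : TopologicalSpace.SeparableSpace (V : Set (Quasilocal ν k)) :=
      TopologicalSpace.SecondCountableTopology.to_separableSpace (α := V)
    exact TopologicalSpace.IsSeparable.of_subtype (V : Set (Quasilocal ν k))
  rw [← TopologicalSpace.isSeparable_univ_iff, ← (dense_iUnion_localAlgebra ν k).closure_eq]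
  exact h1.closure

theorem overwrite_comm {X Z : Finset (Lattice ν)} (h : Disjoint X Z) (σ : Config ν k)
    (t : X → Fin k) (s : Z → Fin k) :
    overwrite (overwrite σ t) s = overwrite (overwrite σ s) t := by
  ext x
  by_cases hx : x ∈ X
  · simp [overwrite, hx, Finset.disjoint_left.1 h hx]
  · simp [overwrite, hx]

theorem restrict_overwrite_of_disjoint {X Z : Finset (Lattice ν)} (h : Disjoint X Z)
    (σ : Config ν k) (t : X → Fin k) : Z.restrict (overwrite σ t) = Z.restrict σ := by
  ext ⟨x, hx⟩
  simp [overwrite, Finset.disjoint_right.1 h hx]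

/-- Observables localized in disjoint volumes commute. -/
theorem mul_comm_of_disjoint {X Z : Finset (Lattice ν)} (h : Disjoint X Z) {a b : Quasilocal ν k}
    (ha : a ∈ localAlgebra k X) (hb : b ∈ localAlgebra k Z) : a * b = b * a := by
  obtain ⟨M, rfl⟩ := ha
  obtain ⟨N, rfl⟩ := hb
  refine Subtype.ext ?_
  change localRep X M * localRep Z N = localRep Z N * localRep X M
  ext ψ σ
  simp only [localRep_apply, mul_apply_eq_comp, localOp_apply, restrict_overwrite_of_disjoint h,
    restrict_overwrite_of_disjoint h.symm, Finset.mul_sum]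
  rw [Finset.sum_comm]
  refine Finset.sum_congr rfl fun s _ => Finset.sum_congr rfl fun t _ => ?_
  rw [overwrite_comm h]
  ring

theorem translation_neg_cancel (x : Lattice ν) (a : Quasilocal ν k) :
    translation (-x) (translation x a) = a := by
  rw [← translation_add, neg_add_cancel, translation_zero]

theorem norm_translation (x : Lattice ν) (a : Quasilocal ν k) : ‖translation x a‖ = ‖a‖ :=
  NonUnitalStarAlgHom.norm_map (translation x)
    (Function.LeftInverse.injective (translation_neg_cancel x)) a

/-- Composition of a functional with the translation by `x`. -/
def compTranslation (x : Lattice ν) (φ : StrongDual ℂ (Quasilocal ν k)) :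
    StrongDual ℂ (Quasilocal ν k) :=
  φ.comp (LinearMap.mkContinuous (translation (k := k) x : _ →ₐ[ℂ] Quasilocal ν k).toLinearMap 1
    fun a => by rw [one_mul]; exact (norm_translation x a).le)

theorem compTranslation_apply (x : Lattice ν) (φ : StrongDual ℂ (Quasilocal ν k))
    (a : Quasilocal ν k) : compTranslation x φ a = φ (translation x a) := rfl

theorem compTranslation_mem (x : Lattice ν) {φ : StrongDual ℂ (Quasilocal ν k)}
    (hφ : φ ∈ normedStates ν k) : compTranslation x φ ∈ normedStates ν k := by
  refine ⟨⟨fun a => ?_, ?_⟩, ContinuousLinearMap.opNorm_le_bound _ zero_le_one fun a => ?_⟩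
  · rw [compTranslation_apply, map_mul, map_star]
    exact hφ.1.1 _
  · rw [compTranslation_apply, map_one]
    exact hφ.1.2
  · rw [compTranslation_apply, ← norm_translation x a]
    exact φ.le_of_opNorm_le hφ.2 _

theorem IsNearGround.compTranslation {x : Lattice ν} {H : Quasilocal ν k} {ε : ℝ}
    {φ : StrongDual ℂ (Quasilocal ν k)} (h : IsNearGround (translation x H) ε φ) :
    IsNearGround H ε (compTranslation x φ) := by
  intro a
  obtain ⟨t, ht, hat⟩ := h (translation x a)
  refine ⟨t, ht, ?_⟩
  rw [norm_translation] at hat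
  rw [compTranslation_apply]
  simpa only [map_mul, map_sub, map_star] using hat

theorem mem_shift {x y : Lattice ν} {Z : Finset (Lattice ν)} : y ∈ shift x Z ↔ y - x ∈ Z := by
  simp [shift, sub_eq_add_neg]

theorem shift_neg_shift (x : Lattice ν) (Z : Finset (Lattice ν)) : shift (-x) (shift x Z) = Z := by
  ext y; simp [mem_shift]

theorem shift_shift_neg (x : Lattice ν) (Z : Finset (Lattice ν)) : shift x (shift (-x) Z) = Z := by
  ext y; simp [mem_shift]

/-- The translation of finite volumes by `x`, as a permutation. -/
def shiftEquiv (x : Lattice ν) : Finset (Lattice ν) ≃ Finset (Lattice ν) where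
  toFun := shift x
  invFun := shift (-x)
  left_inv := shift_neg_shift x
  right_inv := shift_shift_neg x

/-! ### Interactions -/

variable {Ω : Type*} [MeasurableSpace Ω] {P : Measure Ω}
  {h : Ω → Finset (Lattice ν) → Quasilocal ν k}

/-- A weakly measurable map with values in a finite-dimensional subspace is strongly measurable:
its coordinates are restrictions of continuous functionals. -/
theorem aestronglyMeasurable_of_forall_strongDual {A : Type*} [NormedAddCommGroup A]
    [NormedSpace ℂ A] {f : Ω → A} (V : Submodule ℂ A) [FiniteDimensional ℂ V]
    (hV : ∀ᵐ ω ∂P, f ω ∈ V) (hf : ∀ φ : StrongDual ℂ A, Measurable fun ω => φ (f ω)) :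
    AEStronglyMeasurable f P := by
  obtain ⟨π, hπ⟩ := Submodule.ClosedComplemented.of_finiteDimensional V
  let b := Module.finBasis ℂ V
  have hm : StronglyMeasurable fun ω => ∑ i, (b.coord i (π (f ω))) • (b i : A) := by
    refine Finset.stronglyMeasurable_fun_sum _ fun i _ => ?_
    refine StronglyMeasurable.smul_const ?_ _
    exact (hf ((LinearMap.toContinuousLinearMap (b.coord i)).comp π)).stronglyMeasurable
  refine ⟨_, hm, ?_⟩
  filter_upwards [hV] with ω hω
  have h1 : π (f ω) = ⟨f ω, hω⟩ := hπ ⟨f ω, hω⟩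
  have h2 := congrArg (Subtype.val) (b.sum_repr ⟨f ω, hω⟩)
  simp only [Submodule.coe_sum, Submodule.coe_smul] at h2
  rw [h1]
  exact h2.symm

theorem IsDisorderedInteraction.aestronglyMeasurable (hh : IsDisorderedInteraction P h)
    (Z : Finset (Lattice ν)) : AEStronglyMeasurable (fun ω => h ω Z) P :=
  aestronglyMeasurable_of_forall_strongDual (localAlgebra k Z).toSubalgebra.toSubmodule
    (hh.mem_localAlgebra Z) (hh.measurable Z)

theorem fNorm_eq_of_translation {F : ℝ≥0 → ℝ≥0} {Φ Φ' : Finset (Lattice ν) → Quasilocal ν k}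
    (x : Lattice ν) (hΦ : ∀ Z, translation x (Φ Z) = Φ' (shift x Z)) :
    FNorm F Φ' = FNorm F Φ := by
  have hn : ∀ Z, ‖Φ' (shift x Z)‖ₑ = ‖Φ Z‖ₑ := fun Z => by
    rw [← hΦ, ← ofReal_norm, ← ofReal_norm, norm_translation]
  refine ((Equiv.addRight x).iSup_comp (g := fun u => ⨆ v, _)).symm.trans
    (iSup_congr fun u => ((Equiv.addRight x).iSup_comp (g := fun v => _)).symm.trans
      (iSup_congr fun v => ?_))
  refine (Equiv.tsum_eq ((shiftEquiv x).subtypeEquiv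
    (p := fun Z => u ∈ Z ∧ v ∈ Z) fun Z => ?_) _).symm.trans ?_
  · simp [shiftEquiv, mem_shift]
  · refine tsum_congr fun Z => ?_
    change ‖Φ' (shift x Z.1)‖ₑ / _ = _
    rw [hn]
    congr 3
    simp

/-- By ergodicity, the event that the `F`-norm is finite has probability zero or one. -/
theorem ae_fNorm_lt_top [AddAction (Lattice ν) Ω] [MeasurableConstVAdd (Lattice ν) Ω]
    [ErgodicVAdd (Lattice ν) Ω P] (hh : IsErgodicInteraction P h) {F : ℝ≥0 → ℝ≥0}
    (hfin : 0 < P {ω | FNorm F (h ω) < ∞}) : ∀ᵐ ω ∂P, FNorm F (h ω) < ∞ := by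
  have hm : AEMeasurable (fun ω => FNorm F (h ω)) P := by
    refine AEMeasurable.iSup fun x => AEMeasurable.iSup fun y => AEMeasurable.tsum fun Z => ?_
    exact (hh.aestronglyMeasurable Z.1).enorm.div_const _
  have hs : NullMeasurableSet {ω | FNorm F (h ω) < ∞} P := hm.nullMeasurable measurableSet_Iio
  have hinv : ∀ x : Lattice ν, (fun ω => x +ᵥ ω) ⁻¹' {ω | FNorm F (h ω) < ∞}
      =ᵐ[P] {ω | FNorm F (h ω) < ∞} := by
    intro x
    filter_upwards [ae_all_iff.2 (hh.covariant x)] with ω hω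
    have := fNorm_eq_of_translation (F := F) x hω
    change (FNorm F (h (x +ᵥ ω)) < ∞) = (FNorm F (h ω) < ∞)
    rw [this]
  have hc := aeconst_of_forall_preimage_vadd_ae_eq (Lattice ν) hs hinv
  rw [eventuallyConst_set] at hc
  refine hc.resolve_right fun h0 => hfin.ne' ?_
  exact measure_eq_zero_iff_ae_notMem.2 h0

/-- An interaction of finite `F`-norm is absolutely summable over the volumes that meet a given
finite volume. Only the diagonal terms `x = y` of the `F`-norm are needed. -/
theorem summable_norm_of_fNorm_lt_top {F : ℝ≥0 → ℝ≥0} {Φ : Finset (Lattice ν) → Quasilocal ν k}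
    (hΦ : FNorm F Φ < ∞) (X : Finset (Lattice ν)) :
    Summable fun Z : {Z : Finset (Lattice ν) // ¬ Disjoint Z X} => ‖Φ Z.1‖ := by
  have h1 : ∀ x : Lattice ν, ∑' Z : {Z : Finset (Lattice ν) // x ∈ Z}, ‖Φ Z.1‖ₑ ≠ ∞ := by
    intro x htop
    have h2 : ∑' Z : {Z : Finset (Lattice ν) // x ∈ Z ∧ x ∈ Z}, ‖Φ Z.1‖ₑ / (F (nndist x x) : ℝ≥0∞)
        ≤ FNorm F Φ := le_iSup₂_of_le x x le_rfl
    have h3 := h2.trans_lt hΦ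
    simp only [div_eq_mul_inv, ENNReal.tsum_mul_right] at h3
    have h4 : ∑' Z : {Z : Finset (Lattice ν) // x ∈ Z ∧ x ∈ Z}, ‖Φ Z.1‖ₑ = ∞ := by
      rw [← htop]
      exact Equiv.tsum_eq (Equiv.subtypeEquivRight fun Z => and_self_iff)
        (fun Z : {Z : Finset (Lattice ν) // x ∈ Z} => ‖Φ Z.1‖ₑ)
    rw [h4, ENNReal.top_mul (ENNReal.inv_ne_zero.2 ENNReal.coe_ne_top)] at h3
    exact lt_irrefl _ h3
  have h5 : ∑' Z : {Z : Finset (Lattice ν) // ¬ Disjoint Z X}, ‖Φ Z.1‖ₑ ≠ ∞ := by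
    have hset : {Z : Finset (Lattice ν) | ¬ Disjoint Z X} = ⋃ x ∈ X, {Z | x ∈ Z} := by
      ext Z
      simp [Finset.not_disjoint_iff, and_comm]
    have h6 : ∑' Z : {Z : Finset (Lattice ν) | ¬ Disjoint Z X}, ‖Φ Z.1‖ₑ
        ≤ ∑ x ∈ X, ∑' Z : {Z : Finset (Lattice ν) | x ∈ Z}, ‖Φ Z.1‖ₑ := by
      rw [hset]
      exact ENNReal.tsum_biUnion_le (fun Z => ‖Φ Z‖ₑ) X _
    exact ne_top_of_le_ne_top (ENNReal.sum_ne_top.2 fun x _ => h1 x) h6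
  have h7 := ENNReal.summable_toReal h5
  simpa using h7

/-! ### Approximate ground states in infinite volume -/

/-- The cube `{-n, …, n}^ν`. -/
def box (ν n : ℕ) : Finset (Lattice ν) := Finset.Icc (fun _ => -(n : ℤ)) (fun _ => (n : ℤ))

theorem mem_box {n : ℕ} {x : Lattice ν} : x ∈ box ν n ↔ ∀ i, -(n : ℤ) ≤ x i ∧ x i ≤ n := by
  simp [box, Pi.le_def, forall_and]

theorem card_box (ν n : ℕ) : (box ν n).card = (2 * n + 1) ^ ν := by
  rw [box, Pi.card_Icc]
  simp only [Int.card_Icc, Finset.prod_const, Finset.card_univ, Fintype.card_fin]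
  congr 1
  omega

theorem box_mono : Monotone (box ν) := fun n m hnm x hx => by
  rw [mem_box] at hx ⊢
  intro i
  have := hx i
  omega

theorem exists_subset_box (Z : Finset (Lattice ν)) : ∃ n, Z ⊆ box ν n := by
  refine ⟨Z.sup fun x => Finset.univ.sup fun i => (x i).natAbs, fun x hx => mem_box.2 fun i => ?_⟩
  have h1 : (x i).natAbs ≤ Z.sup fun x => Finset.univ.sup fun i => (x i).natAbs :=
    (Finset.le_sup (f := fun i => (x i).natAbs) (Finset.mem_univ i)).trans
      (Finset.le_sup (f := fun x : Lattice ν => Finset.univ.sup fun i => (x i).natAbs) hx)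
  omega

/-- The total norm of the terms of an interaction that meet `X` and are not contained in the cube
of size `n`. -/
def tailNorm (Φ : Finset (Lattice ν) → Quasilocal ν k) (X : Finset (Lattice ν)) (n : ℕ) : ℝ :=
  ∑' Z : {Z : Finset (Lattice ν) // ¬ Disjoint Z X}, if Z.1 ⊆ box ν n then 0 else ‖Φ Z.1‖

section Tail

variable {Φ : Finset (Lattice ν) → Quasilocal ν k} {X : Finset (Lattice ν)}

theorem summable_tail
    (hΦ : Summable fun Z : {Z : Finset (Lattice ν) // ¬ Disjoint Z X} => ‖Φ Z.1‖) (n : ℕ) :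
    Summable fun Z : {Z : Finset (Lattice ν) // ¬ Disjoint Z X} =>
      if Z.1 ⊆ box ν n then 0 else ‖Φ Z.1‖ :=
  hΦ.of_nonneg_of_le (fun Z => by split_ifs <;> positivity)
    (fun Z => by split_ifs; exacts [norm_nonneg _, le_rfl])

theorem tailNorm_antitone
    (hΦ : Summable fun Z : {Z : Finset (Lattice ν) // ¬ Disjoint Z X} => ‖Φ Z.1‖) :
    Antitone (tailNorm Φ X) := fun n m hnm => by
  refine (summable_tail hΦ m).tsum_le_tsum (fun Z => ?_) (summable_tail hΦ n)
  by_cases h : Z.1 ⊆ box ν n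
  · simp [h, h.trans (box_mono hnm)]
  · rw [if_neg h]
    split_ifs
    exacts [norm_nonneg _, le_rfl]

theorem tendsto_tailNorm
    (hΦ : Summable fun Z : {Z : Finset (Lattice ν) // ¬ Disjoint Z X} => ‖Φ Z.1‖) :
    Tendsto (tailNorm Φ X) atTop (𝓝 0) := by
  have h := tendsto_tsum_of_dominated_convergence (𝓕 := atTop)
    (f := fun n (Z : {Z : Finset (Lattice ν) // ¬ Disjoint Z X}) =>
      if Z.1 ⊆ box ν n then 0 else ‖Φ Z.1‖) (g := fun _ => (0 : ℝ)) hΦ (fun Z => ?_)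
    (.of_forall fun n Z => ?_)
  · rw [tsum_zero] at h
    exact h
  · obtain ⟨N, hN⟩ := exists_subset_box Z.1
    refine tendsto_const_nhds.congr' ?_
    filter_upwards [eventually_ge_atTop N] with n hn
    rw [if_pos (hN.trans (box_mono hn))]
  · split_ifs <;> simp

theorem norm_commutator_le (a b : Quasilocal ν k) : ‖b * a - a * b‖ ≤ 2 * ‖a‖ * ‖b‖ := by
  refine (norm_sub_le _ _).trans ?_
  have h1 := norm_mul_le b a
  have h2 := norm_mul_le a b
  linarith [mul_comm ‖a‖ ‖b‖]

theorem derivationTerm_eq (a : Quasilocal ν k)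
    (Z : {Z : Finset (Lattice ν) // ¬ Disjoint Z X}) :
    derivationTerm Φ X a Z = Complex.I • (Φ Z.1 * a - a * Φ Z.1) := by
  rw [derivationTerm, smul_mul_assoc, mul_smul_comm, smul_sub]

theorem summable_commutator
    (hΦ : Summable fun Z : {Z : Finset (Lattice ν) // ¬ Disjoint Z X} => ‖Φ Z.1‖)
    (a : Quasilocal ν k) :
    Summable fun Z : {Z : Finset (Lattice ν) // ¬ Disjoint Z X} => Φ Z.1 * a - a * Φ Z.1 :=
  .of_norm_bounded (hΦ.mul_left (2 * ‖a‖)) fun Z => norm_commutator_le a (Φ Z.1)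

/-- The derivation of an interaction is close to the commutator with the Hamiltonian of a large
finite volume. -/
theorem norm_derivation_sub_le
    (hΦ : Summable fun Z : {Z : Finset (Lattice ν) // ¬ Disjoint Z X} => ‖Φ Z.1‖)
    (hloc : ∀ Z, Φ Z ∈ localAlgebra k Z) {a : Quasilocal ν k} (ha : a ∈ localAlgebra k X)
    {Λ : Finset (Lattice ν)} {n : ℕ} (hΛ : box ν n ⊆ Λ) :
    ‖-Complex.I • ∑' Z, derivationTerm Φ X a Z
      - ((∑ Z ∈ Λ.powerset, Φ Z) * a - a * ∑ Z ∈ Λ.powerset, Φ Z)‖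
      ≤ 2 * ‖a‖ * tailNorm Φ X n := by
  have h1 : -Complex.I • ∑' Z, derivationTerm Φ X a Z
      = ∑' Z : {Z : Finset (Lattice ν) // ¬ Disjoint Z X}, (Φ Z.1 * a - a * Φ Z.1) := by
    simp only [derivationTerm_eq]
    rw [(summable_commutator hΦ a).tsum_const_smul, smul_smul]
    simp
  have h2 : (∑ Z ∈ Λ.powerset, Φ Z) * a - a * ∑ Z ∈ Λ.powerset, Φ Z
      = ∑' Z : {Z : Finset (Lattice ν) // ¬ Disjoint Z X},
        if Z.1 ⊆ Λ then Φ Z.1 * a - a * Φ Z.1 else 0 := by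
    rw [Finset.sum_mul, Finset.mul_sum, ← Finset.sum_sub_distrib]
    have h3 : ∑' Z : {Z : Finset (Lattice ν) | ¬ Disjoint Z X},
        (if Z.1 ⊆ Λ then Φ Z.1 * a - a * Φ Z.1 else 0)
        = ∑' Z, if Z ⊆ Λ then Φ Z * a - a * Φ Z else 0 := by
      refine tsum_subtype_eq_of_support_subset (f := fun Z : Finset (Lattice ν) =>
        if Z ⊆ Λ then Φ Z * a - a * Φ Z else 0) fun Z hZ hd => hZ ?_
      simp [mul_comm_of_disjoint hd (hloc Z) ha]
    refine Eq.trans ?_ h3.symm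
    rw [tsum_eq_sum (s := Λ.powerset) fun Z hZ => if_neg (by simpa using hZ)]
    exact Finset.sum_congr rfl fun Z hZ => (if_pos (Finset.mem_powerset.1 hZ)).symm
  have h4 : Summable fun Z : {Z : Finset (Lattice ν) // ¬ Disjoint Z X} =>
      if Z.1 ⊆ Λ then Φ Z.1 * a - a * Φ Z.1 else 0 :=
    .of_norm_bounded (hΦ.mul_left (2 * ‖a‖)) fun Z => by
      split_ifs
      · exact norm_commutator_le a (Φ Z.1)
      · rw [norm_zero]; positivity
  rw [h1, h2, ← (summable_commutator hΦ a).tsum_sub h4]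
  refine tsum_of_norm_bounded ((summable_tail hΦ n).hasSum.mul_left (2 * ‖a‖)) fun Z => ?_
  by_cases hZ : Z.1 ⊆ Λ
  · rw [if_pos hZ, sub_self, norm_zero]
    split_ifs <;> positivity
  · rw [if_neg hZ, sub_zero, if_neg fun h => hZ (h.trans hΛ)]
    exact norm_commutator_le a (Φ Z.1)

end Tail

/-- The ground state property for the interaction `Φ`, up to an error which tends to zero with
`n`. The error is antitone in `n`. -/
def IsApproxGround (Φ : Finset (Lattice ν) → Quasilocal ν k) (n : ℕ)
    (φ : StrongDual ℂ (Quasilocal ν k)) : Prop :=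
  ∀ X : Finset (Lattice ν), ∀ a ∈ localAlgebra k X, ∃ t : ℝ, 0 ≤ t ∧
    ‖-Complex.I * φ (star a * ∑' Z, derivationTerm Φ X a Z) - t‖
      ≤ (1 / ((n : ℝ) + 1) + 2 * tailNorm Φ X n) * ‖a‖ ^ 2

section ApproxGround

variable {Φ : Finset (Lattice ν) → Quasilocal ν k}

theorem IsApproxGround.anti
    (hΦ : ∀ X, Summable fun Z : {Z : Finset (Lattice ν) // ¬ Disjoint Z X} => ‖Φ Z.1‖)
    {n m : ℕ} (hnm : n ≤ m) {φ : StrongDual ℂ (Quasilocal ν k)} (h : IsApproxGround Φ m φ) :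
    IsApproxGround Φ n φ := fun X a ha => by
  obtain ⟨t, ht, hat⟩ := h X a ha
  refine ⟨t, ht, hat.trans ?_⟩
  gcongr
  exact tailNorm_antitone (hΦ X) hnm

theorem IsNearGround.isApproxGround
    (hΦ : ∀ X, Summable fun Z : {Z : Finset (Lattice ν) // ¬ Disjoint Z X} => ‖Φ Z.1‖)
    (hloc : ∀ Z, Φ Z ∈ localAlgebra k Z) {Λ : Finset (Lattice ν)} {n : ℕ} (hΛ : box ν n ⊆ Λ)
    {φ : StrongDual ℂ (Quasilocal ν k)} (hφ : ‖φ‖ ≤ 1)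
    (h : IsNearGround (∑ Z ∈ Λ.powerset, Φ Z) (1 / ((n : ℝ) + 1)) φ) :
    IsApproxGround Φ n φ := fun X a ha => by
  obtain ⟨t, ht, hat⟩ := h a
  refine ⟨t, ht, ?_⟩
  have hD := norm_derivation_sub_le (hΦ X) hloc ha hΛ
  set D := ∑' Z, derivationTerm Φ X a Z
  set H := ∑ Z ∈ Λ.powerset, Φ Z
  have h1 : -Complex.I * φ (star a * D) - t
      = φ (star a * (-Complex.I • D - (H * a - a * H))) + (φ (star a * (H * a - a * H)) - t) := by
    rw [← add_sub_assoc, ← map_add, ← mul_add, sub_add_cancel, mul_smul_comm, map_smul, smul_eq_mul]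
  have h2 : ‖φ (star a * (-Complex.I • D - (H * a - a * H)))‖
      ≤ ‖a‖ * (2 * ‖a‖ * tailNorm Φ X n) := by
    refine ((φ.le_of_opNorm_le hφ _).trans_eq (one_mul _)).trans ((norm_mul_le _ _).trans ?_)
    rw [norm_star]
    gcongr
  rw [h1]
  refine (norm_add_le _ _).trans ((add_le_add h2 hat).trans_eq ?_)
  ring

/-- Averages of numbers close to `[0, ∞)` are close to `[0, ∞)`. -/
theorem exists_nonneg_norm_average_sub_le {J : Type*} {s : Finset J} (hs : s.Nonempty) {z : J → ℂ}
    {ε : ℝ} (hz : ∀ i ∈ s, ∃ t : ℝ, 0 ≤ t ∧ ‖z i - t‖ ≤ ε) :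
    ∃ t : ℝ, 0 ≤ t ∧ ‖(s.card : ℂ)⁻¹ * ∑ i ∈ s, z i - t‖ ≤ ε := by
  choose! t ht hzt using hz
  have hc : (0 : ℝ) < s.card := by exact_mod_cast hs.card_pos
  refine ⟨(s.card : ℝ)⁻¹ * ∑ i ∈ s, t i,
    mul_nonneg (inv_nonneg.2 hc.le) (Finset.sum_nonneg ht), ?_⟩
  push_cast
  rw [← mul_sub, ← Finset.sum_sub_distrib, norm_mul, norm_inv, RCLike.norm_natCast,
    inv_mul_le_iff₀ hc]
  refine (norm_sum_le _ _).trans ((Finset.sum_le_sum hzt).trans_eq ?_)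
  rw [Finset.sum_const, nsmul_eq_mul]

theorem average_apply {J : Type*} (s : Finset J) (φ : J → StrongDual ℂ (Quasilocal ν k))
    (a : Quasilocal ν k) :
    ((s.card : ℂ)⁻¹ • ∑ i ∈ s, φ i) a = (s.card : ℂ)⁻¹ * ∑ i ∈ s, φ i a := by
  simp

theorem average_mem_normedStates {J : Type*} {s : Finset J} (hs : s.Nonempty)
    {φ : J → StrongDual ℂ (Quasilocal ν k)} (hφ : ∀ i ∈ s, φ i ∈ normedStates ν k) :
    (s.card : ℂ)⁻¹ • ∑ i ∈ s, φ i ∈ normedStates ν k := by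
  have hc : (0 : ℝ) < s.card := by exact_mod_cast hs.card_pos
  have hc' : (s.card : ℂ) ≠ 0 := by exact_mod_cast hs.card_pos.ne'
  refine ⟨⟨fun a => ?_, ?_⟩, ?_⟩
  · rw [average_apply]
    refine mul_nonneg ?_ (Finset.sum_nonneg fun i hi => (hφ i hi).1.1 a)
    have := Complex.zero_le_real.2 (inv_nonneg.2 hc.le)
    rwa [Complex.ofReal_inv, Complex.ofReal_natCast] at this
  · rw [average_apply, Finset.sum_congr rfl fun i hi => (hφ i hi).1.2]
    simp [hc']
  · rw [norm_smul, norm_inv, RCLike.norm_natCast, inv_mul_le_iff₀ hc]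
    refine (norm_sum_le _ _).trans ((Finset.sum_le_sum fun i hi => (hφ i hi).2).trans_eq ?_)
    rw [Finset.sum_const, nsmul_eq_mul]

theorem IsApproxGround.average {J : Type*} {s : Finset J} (hs : s.Nonempty)
    {φ : J → StrongDual ℂ (Quasilocal ν k)} {n : ℕ} (hφ : ∀ i ∈ s, IsApproxGround Φ n (φ i)) :
    IsApproxGround Φ n ((s.card : ℂ)⁻¹ • ∑ i ∈ s, φ i) := fun X a ha => by
  obtain ⟨t, ht, h⟩ := exists_nonneg_norm_average_sub_le hs fun i hi => hφ i hi X a ha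
  refine ⟨t, ht, ?_⟩
  rw [average_apply, mul_left_comm, Finset.mul_sum]
  exact h

theorem midpoint_eq_average (φ φ' : StrongDual ℂ (Quasilocal ν k)) :
    (2⁻¹ : ℂ) • (φ + φ')
      = ((Finset.univ : Finset Bool).card : ℂ)⁻¹ • ∑ b : Bool, bif b then φ else φ' := by
  simp

/-- The set of states is sequentially closed for the weak-* topology. -/
theorem mem_normedStates_of_tendsto (φ : ℕ → StrongDual ℂ (Quasilocal ν k))
    (ψ : StrongDual ℂ (Quasilocal ν k)) (hφ : ∀ n, φ n ∈ normedStates ν k)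
    (h : ∀ a, Tendsto (fun n => φ n a) atTop (𝓝 (ψ a))) : ψ ∈ normedStates ν k := by
  refine ⟨⟨fun a => ge_of_tendsto' (h _) fun n => (hφ n).1.1 a, ?_⟩, ?_⟩
  · exact tendsto_nhds_unique (h 1) (tendsto_const_nhds.congr fun n => ((hφ n).1.2).symm)
  · exact ContinuousLinearMap.opNorm_le_bound _ zero_le_one fun a =>
      le_of_tendsto' (h a).norm fun n => (φ n).le_of_opNorm_le (hφ n).2 a

theorem isGroundState_of_tendsto
    (hΦ : ∀ X, Summable fun Z : {Z : Finset (Lattice ν) // ¬ Disjoint Z X} => ‖Φ Z.1‖)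
    {φ : ℕ → StrongDual ℂ (Quasilocal ν k)} {ψ : StrongDual ℂ (Quasilocal ν k)}
    (hφ : ∀ n, IsApproxGround Φ n (φ n))
    (h : ∀ a, Tendsto (fun n => φ n a) atTop (𝓝 (ψ a))) : IsGroundState Φ ψ := by
  intro X a ha
  constructor
  · refine ((summable_commutator (hΦ X) a).const_smul Complex.I).congr fun Z => ?_
    exact (derivationTerm_eq a Z).symm
  · choose t ht hat using fun n => hφ n X a ha
    have h1 := (h (star a * ∑' Z, derivationTerm Φ X a Z)).const_mul (-Complex.I)
    have h2 : Tendsto (fun n : ℕ => (1 / ((n : ℝ) + 1) + 2 * tailNorm Φ X n) * ‖a‖ ^ 2) atTop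
        (𝓝 0) := by
      simpa using ((tendsto_one_div_add_atTop_nhds_zero_nat (𝕜 := ℝ)).add
        ((tendsto_tailNorm (hΦ X)).const_mul 2)).mul_const (‖a‖ ^ 2)
    have h3 := h1.sub (squeeze_zero_norm hat h2)
    simp only [sub_sub_cancel, sub_zero] at h3
    exact ge_of_tendsto' h3 fun n => Complex.zero_le_real.2 (ht n)

end ApproxGround

/-! ### Averages over cubes -/

/-- The largest absolute value of a coordinate of `x`. -/
def latticeNorm (x : Lattice ν) : ℕ := Finset.univ.sup fun i => (x i).natAbs

/-- A bound, antitone in `n`, for the relative size of the symmetric difference of the cube of size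
`n` and its translate by `x`. -/
def folnerError (x : Lattice ν) (n : ℕ) : ℝ :=
  2 * ((1 + 2 * latticeNorm x * (1 / (2 * (n : ℝ) + 1))) ^ ν - 1)

theorem folnerError_antitone (x : Lattice ν) : Antitone (folnerError x) := fun n m hnm => by
  unfold folnerError
  gcongr

theorem tendsto_folnerError (x : Lattice ν) : Tendsto (folnerError x) atTop (𝓝 0) := by
  have h1 : Tendsto (fun n : ℕ => 1 / (2 * (n : ℝ) + 1)) atTop (𝓝 0) := by
    simp only [one_div]
    refine tendsto_inv_atTop_zero.comp (tendsto_atTop_add_const_right _ _ ?_)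
    exact tendsto_natCast_atTop_atTop.const_mul_atTop two_pos
  have h2 := ((((h1.const_mul (2 * (latticeNorm x : ℝ))).const_add 1).pow ν).sub_const 1).const_mul 2
  simp only [mul_zero, add_zero, one_pow, sub_self] at h2
  exact h2

/-- The averages of a bounded function over a cube and over its translate are close. -/
theorem norm_sum_shift_box_sub_le (x : Lattice ν) (n : ℕ) (G : Lattice ν → ℂ) {M : ℝ}
    (hG : ∀ z, ‖G z‖ ≤ M) :
    ‖∑ z ∈ shift x (box ν n), G z - ∑ z ∈ box ν n, G z‖
      ≤ (box ν n).card * (folnerError x n * M) := by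
  have hM : 0 ≤ M := (norm_nonneg _).trans (hG 0)
  rw [← Finset.sum_sdiff_sub_sum_sdiff]
  have hcard : (shift x (box ν n)).card = (box ν n).card := Finset.card_map _
  have h1 : ((shift x (box ν n) \ box ν n).card : ℝ)
      ≤ (2 * (n + latticeNorm x : ℕ) + 1) ^ ν - (2 * (n : ℝ) + 1) ^ ν := by
    have hsub : shift x (box ν n) ⊆ box ν (n + latticeNorm x) := fun z hz => by
      rw [mem_shift, mem_box] at hz
      rw [mem_box]
      intro i
      have h2 := hz i
      rw [Pi.sub_apply] at h2
      have h3 : (x i).natAbs ≤ latticeNorm x :=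
        Finset.le_sup (f := fun i => (x i).natAbs) (Finset.mem_univ i)
      push_cast
      omega
    have h4 := Finset.card_le_card (Finset.sdiff_subset_sdiff hsub (Finset.Subset.refl (box ν n)))
    have h5 := Finset.card_sdiff_add_card_eq_card (box_mono (ν := ν) (Nat.le_add_right n
      (latticeNorm x)))
    rw [card_box, card_box] at h5
    have h6 : (shift x (box ν n) \ box ν n).card + (2 * n + 1) ^ ν
        ≤ (2 * (n + latticeNorm x) + 1) ^ ν := by omega
    rw [le_sub_iff_add_le]
    exact_mod_cast h6
  have h2 : (box ν n \ shift x (box ν n)).card = (shift x (box ν n) \ box ν n).card :=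
    Finset.card_sdiff_comm hcard.symm
  have h3 : ∀ s : Finset (Lattice ν), ‖∑ z ∈ s, G z‖ ≤ s.card * M := fun s => by
    refine (norm_sum_le _ _).trans ((Finset.sum_le_sum fun z _ => hG z).trans_eq ?_)
    rw [Finset.sum_const, nsmul_eq_mul]
  have h4 : ((2 * (n + latticeNorm x : ℕ) + 1 : ℝ)) ^ ν - (2 * (n : ℝ) + 1) ^ ν
      = (2 * (n : ℝ) + 1) ^ ν * ((1 + 2 * latticeNorm x * (1 / (2 * (n : ℝ) + 1))) ^ ν - 1) := by
    rw [mul_sub, ← mul_pow, mul_one]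
    congr 2
    field_simp
    push_cast
    ring
  calc _ ≤ ((shift x (box ν n) \ box ν n).card * M + (box ν n \ shift x (box ν n)).card * M) :=
        (norm_sub_le _ _).trans (add_le_add (h3 _) (h3 _))
    _ = (shift x (box ν n) \ box ν n).card * (2 * M) := by rw [h2]; ring
    _ ≤ ((2 * (n + latticeNorm x : ℕ) + 1) ^ ν - (2 * (n : ℝ) + 1) ^ ν) * (2 * M) := by gcongr
    _ = _ := by
      rw [h4, card_box, folnerError]
      push_cast
      ring

/-! ### Covariant disordered ground states -/

/-- The random states which are, up to errors that tend to zero with `n`, ground states of the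
random interaction `h` and covariant under translations. -/
def approxCovariantGroundStates (P : Measure Ω) [AddAction (Lattice ν) Ω]
    (h : Ω → Finset (Lattice ν) → Quasilocal ν k) (n : ℕ) :
    Set (Ω → StrongDual ℂ (Quasilocal ν k)) :=
  {Γ | (∀ ω, Γ ω ∈ normedStates ν k) ∧ (∀ a, Measurable fun ω => Γ ω a) ∧
    (∀ᵐ ω ∂P, IsApproxGround (h ω) n (Γ ω)) ∧
    ∀ ω x a, ‖Γ (x +ᵥ ω) (translation x a) - Γ ω a‖ ≤ folnerError x n * ‖a‖}

/-- A random state which is almost surely an approximate ground state of the Hamiltonian of the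
finite volume `Λ`. -/
theorem exists_finite_volume_isNearGround (hk : 0 < k) (hh : IsDisorderedInteraction P h)
    (Λ : Finset (Lattice ν)) {ε : ℝ} (hε : 0 < ε) :
    ∃ Γ : Ω → StrongDual ℂ (Quasilocal ν k), (∀ ω, Γ ω ∈ normedStates ν k) ∧
      (∀ a, Measurable fun ω => Γ ω a) ∧
      ∀ᵐ ω ∂P, IsNearGround (∑ Z ∈ Λ.powerset, h ω Z) ε (Γ ω) := by
  have := separableSpace_quasilocal (ν := ν) (k := k)
  have hm : AEStronglyMeasurable (fun ω => ∑ Z ∈ Λ.powerset, h ω Z) P :=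
    Finset.aestronglyMeasurable_fun_sum _ fun Z _ => hh.aestronglyMeasurable Z
  obtain ⟨g, hg, hae⟩ := hm
  -- The self-adjoint part is self-adjoint everywhere, and almost surely equal to the Hamiltonian.
  obtain ⟨Γ, hΓ, hΓm, hΓg⟩ := exists_measurable_isNearGround (k := k) hk
    (H := fun ω => (2⁻¹ : ℝ) • (g ω + star (g ω)))
    ((hg.add (continuous_star.comp_stronglyMeasurable hg)).const_smul _)
    (fun ω => (IsSelfAdjoint.all (2⁻¹ : ℝ)).smul (.add_star_self _)) hε
  refine ⟨Γ, hΓ, hΓm, ?_⟩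
  filter_upwards [hae, ae_all_iff.2 hh.isSelfAdjoint] with ω h1 h2
  have h3 : IsSelfAdjoint (g ω) := by
    rw [← h1]
    exact isSelfAdjoint_sum _ fun Z _ => h2 Z
  have h4 := hΓg ω
  rw [h3.star_eq, ← two_smul ℝ (g ω), smul_smul, inv_mul_cancel₀ two_ne_zero, one_smul, ← h1] at h4
  exact h4

theorem ae_forall_vadd [AddAction (Lattice ν) Ω] [MeasurableConstVAdd (Lattice ν) Ω]
    [VAddInvariantMeasure (Lattice ν) Ω P] {p : Ω → Prop} (hp : ∀ᵐ ω ∂P, p ω) :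
    ∀ᵐ ω ∂P, ∀ x : Lattice ν, p (x +ᵥ ω) :=
  ae_all_iff.2 fun x => (measurePreserving_vadd x P).quasiMeasurePreserving.ae hp

theorem translation_sum_powerset {Φ Φ' : Finset (Lattice ν) → Quasilocal ν k} {x : Lattice ν}
    (hΦ : ∀ Z, translation x (Φ Z) = Φ' (shift x Z)) (Λ : Finset (Lattice ν)) :
    translation x (∑ Z ∈ (shift (-x) Λ).powerset, Φ Z) = ∑ Z ∈ Λ.powerset, Φ' Z := by
  rw [map_sum]
  refine Finset.sum_equiv (shiftEquiv x) (fun Z => ?_) fun Z _ => hΦ Z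
  simp only [Finset.mem_powerset]
  change Z ⊆ shift (-x) Λ ↔ shift x Z ⊆ Λ
  conv_rhs => rw [← shift_shift_neg x Λ]
  exact (Finset.map_subset_map).symm

/-- Approximately covariant random ground states arise from approximate ground states in the cube
of size `2n` as averages over the translations in the cube of size `n`. -/
theorem approxCovariantGroundStates_nonempty [AddAction (Lattice ν) Ω]
    [MeasurableConstVAdd (Lattice ν) Ω] [ErgodicVAdd (Lattice ν) Ω P] (hk : 0 < k)
    (hh : IsErgodicInteraction P h)
    (hsum : ∀ᵐ ω ∂P, ∀ X,
      Summable fun Z : {Z : Finset (Lattice ν) // ¬ Disjoint Z X} => ‖h ω Z.1‖) (n : ℕ) :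
    (approxCovariantGroundStates P h n).Nonempty := by
  obtain ⟨Γ, hΓ, hΓm, hΓg⟩ := exists_finite_volume_isNearGround hk hh.toIsDisorderedInteraction
    (box ν (2 * n)) (ε := 1 / ((n : ℝ) + 1)) (by positivity)
  have hbox : (box ν n).Nonempty := ⟨0, mem_box.2 fun i => by simp⟩
  refine ⟨fun ω => ((box ν n).card : ℂ)⁻¹ • ∑ x ∈ box ν n, compTranslation x (Γ (x +ᵥ ω)),
    fun ω => average_mem_normedStates hbox fun x _ => compTranslation_mem x (hΓ _),
    fun a => ?_, ?_, fun ω y a => ?_⟩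
  · simp only [average_apply]
    refine (Finset.measurable_fun_sum _ fun x _ => ?_).const_mul _
    exact (hΓm (translation x a)).comp (measurable_const_vadd x)
  · filter_upwards [hsum, ae_all_iff.2 hh.mem_localAlgebra, ae_forall_vadd (ν := ν) hΓg,
      ae_all_iff.2 fun x => ae_all_iff.2 (hh.covariant x)] with ω h1 h2 h3 h4
    refine IsApproxGround.average hbox fun x hx => ?_
    refine IsNearGround.isApproxGround h1 h2 (Λ := shift (-x) (box ν (2 * n))) ?_
      (compTranslation_mem x (hΓ _)).2 (IsNearGround.compTranslation ?_)
    · intro y hy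
      rw [mem_shift, mem_box]
      intro i
      have h5 := mem_box.1 hx i
      have h6 := mem_box.1 hy i
      simp only [sub_neg_eq_add, Pi.add_apply]
      push_cast
      omega
    · rw [translation_sum_powerset (h4 x)]
      exact h3 x
  · have hsh : ∑ x ∈ box ν n, compTranslation x (Γ (x +ᵥ y +ᵥ ω)) (translation y a)
        = ∑ z ∈ shift y (box ν n), Γ (z +ᵥ ω) (translation z a) := by
      rw [shift, Finset.sum_map]
      refine Finset.sum_congr rfl fun x _ => ?_
      simp only [compTranslation_apply, Equiv.coe_toEmbedding, Equiv.coe_addRight, vadd_vadd,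
        translation_add]
    rw [average_apply, average_apply, hsh, ← mul_sub, norm_mul, norm_inv, RCLike.norm_natCast,
      inv_mul_le_iff₀ (by exact_mod_cast hbox.card_pos)]
    refine norm_sum_shift_box_sub_le y n (fun z => Γ (z +ᵥ ω) (translation z a)) fun z => ?_
    rw [← one_mul ‖a‖, ← norm_translation z a]
    exact (Γ _).le_of_opNorm_le (hΓ _).2 _

theorem approxCovariantGroundStates_antitone [AddAction (Lattice ν) Ω]
    (hsum : ∀ᵐ ω ∂P, ∀ X,
      Summable fun Z : {Z : Finset (Lattice ν) // ¬ Disjoint Z X} => ‖h ω Z.1‖) :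
    Antitone (approxCovariantGroundStates P h) := by
  rintro n m hnm Γ ⟨h1, h2, h3, h4⟩
  refine ⟨h1, h2, ?_, fun ω x a => (h4 ω x a).trans ?_⟩
  · filter_upwards [hsum, h3] with ω h5 h6
    exact h6.anti h5 hnm
  · gcongr
    exact folnerError_antitone x hnm

theorem midpoint_mem_approxCovariantGroundStates [AddAction (Lattice ν) Ω] {n : ℕ}
    {Γ Γ' : Ω → StrongDual ℂ (Quasilocal ν k)} (hΓ : Γ ∈ approxCovariantGroundStates P h n)
    (hΓ' : Γ' ∈ approxCovariantGroundStates P h n) :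
    (2⁻¹ : ℂ) • (Γ + Γ') ∈ approxCovariantGroundStates P h n := by
  obtain ⟨h1, h2, h3, h4⟩ := hΓ
  obtain ⟨h1', h2', h3', h4'⟩ := hΓ'
  have hne : (Finset.univ : Finset Bool).Nonempty := Finset.univ_nonempty
  refine ⟨fun ω => ?_, fun a => ?_, ?_, fun ω x a => ?_⟩
  · rw [Pi.smul_apply, Pi.add_apply, midpoint_eq_average]
    exact average_mem_normedStates hne (by rintro (_ | _) -; exacts [h1' ω, h1 ω])
  · exact ((h2 a).add (h2' a)).const_mul (2⁻¹ : ℂ)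
  · filter_upwards [h3, h3'] with ω h5 h5'
    rw [Pi.smul_apply, Pi.add_apply, midpoint_eq_average]
    exact IsApproxGround.average hne (by rintro (_ | _) -; exacts [h5', h5])
  · have h5 := norm_add_le_of_le (h4 ω x a) (h4' ω x a)
    change ‖(2⁻¹ : ℂ) * (Γ (x +ᵥ ω) (translation x a) + Γ' (x +ᵥ ω) (translation x a))
      - (2⁻¹ : ℂ) * (Γ ω a + Γ' ω a)‖ ≤ _
    rw [← mul_sub, add_sub_add_comm, norm_mul]
    rw [norm_inv, RCLike.norm_ofNat]
    linarith

end SpinSystem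

end

open SpinSystem in
theorem theorem4 {ν k : ℕ} (hk : 0 < k)
    {Ω : Type*} [MeasurableSpace Ω] [MeasurableSpace.CountablyGenerated Ω]
    (P : Measure Ω) [IsProbabilityMeasure P]
    [AddAction (Lattice ν) Ω] [MeasurableConstVAdd (Lattice ν) Ω] [ErgodicVAdd (Lattice ν) Ω P]
    (h : Ω → Finset (Lattice ν) → Quasilocal ν k) (hh : IsErgodicInteraction P h)
    (F : ℝ≥0 → ℝ≥0) (hF : IsFFunction ν F) (hfin : 0 < P {ω | FNorm F (h ω) < ∞}) :
    ∃ Γ : Ω → StrongDual ℂ (Quasilocal ν k),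
      IsDisorderedGroundState P h Γ ∧
      ∀ᵐ ω ∂P, ∀ (x : Lattice ν) (a : Quasilocal ν k), Γ (x +ᵥ ω) (translation x a) = Γ ω a := by
  have := separableSpace_quasilocal (ν := ν) (k := k)
  have hsum : ∀ᵐ ω ∂P, ∀ X,
      Summable fun Z : {Z : Finset (Lattice ν) // ¬ Disjoint Z X} => ‖h ω Z.1‖ := by
    filter_upwards [ae_fNorm_lt_top hh hfin] with ω hω X
    exact summable_norm_of_fNorm_lt_top hω X
  have hanti := approxCovariantGroundStates_antitone hsum
  have hne := approxCovariantGroundStates_nonempty hk hh hsum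
  obtain ⟨Γ₀, hΓ₀⟩ := hne 0
  have : Nonempty Ω := nonempty_of_isProbabilityMeasure P
  obtain ⟨Γs, Γ, hΓs, hΓ, hΓm, hlim⟩ := exists_ae_tendsto_of_antitone_of_midpoint_mem P
    (S := normedStates ν k) ⟨_, hΓ₀.1 (Classical.arbitrary Ω)⟩ (fun φ hφ => hφ.2)
    mem_normedStates_of_tendsto hanti hne (fun Γ hΓ => hΓ.1) (fun Γ hΓ => hΓ.2.1)
    (fun n Γ hΓ Γ' hΓ' => midpoint_mem_approxCovariantGroundStates hΓ hΓ')
  refine ⟨Γ, ⟨fun ω => (hΓ ω).1, hΓm, ?_⟩, ?_⟩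
  · filter_upwards [hsum, hlim, ae_all_iff.2 fun n => (hΓs n).2.2.1] with ω h1 h2 h3
    exact isGroundState_of_tendsto h1 h3 h2
  · filter_upwards [hlim, ae_forall_vadd (ν := ν) hlim] with ω h1 h2 x a
    have h3 := squeeze_zero_norm (fun n => (hΓs n).2.2.2 ω x a)
      (by simpa using (tendsto_folnerError x).mul_const ‖a‖)
    exact sub_eq_zero.1 (tendsto_nhds_unique ((h2 x (translation x a)).sub (h1 a)) h3)
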